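/- Let $I_1,I_2$ be independent random variables such that, for $i=1,2$, $I_i$ has the mixture Exponential-Generalized Gamma density $$f_{I_i}(x)=\frac{\omega_i}{\lambda_i}e^{-x/\lambda_i}+(1-\omega_i)\frac{c_i\,x^{a_ic_i-1}}{b_i^{a_ic_i}\Gamma(a_i)}e^{-(x/b_i)^{c_i}},\qquad x>0,$$ where $0<\omega_i<1$ and $\lambda_i,a_i,b_i,c_i>0$. Let $r_1,r_2\in\{1,2\}$, let $\eta,N_{01},N_{02},C>0$, and put $\gamma_i=(\eta I_i)^{r_i}/N_{0i}$ and $\mu_i=\eta^{r_i}/N_{0i}$. Let $\gamma=\gamma_1\gamma_2/(\gamma_2+C)$ be the end-to-end SNR of the dual-hop system. Let $n\in\mathbb N$, $\delta\in\mathbb R$, $p>0$ and $q_1,\dots,q_n>0$. For $x,y>0$ and pairs $u=(u_1,u_2)$, $v=(v_1,v_2)$ of real numbers, the bivariate Fox H-function $$H(u,v;x,y)=\mathrm H^{0,1:1,1:2,0}_{1,0:1,2:0,2}\left[\begin{matrix}(1;1,1)\\ -\end{matrix}\middle|\begin{matrix}u\\(p,1)(0,1)\end{matrix}\middle|\begin{matrix}-\\(0,1)\,v\end{matrix}\middle|\,x,y\right]$$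 is the double Mellin-Barnes integral $$\frac1{(2\pi i)^2}\int_{\operatorname{Re}s=\sigma}\int_{\operatorname{Re}t=\tau}\Gamma(s+t)\,\frac{\Gamma(p-s)\,\Gamma(1-u_1+u_2s)}{\Gamma(1+s)}\,\Gamma(-t)\,\Gamma(v_1-v_2t)\,x^s y^t\,dt\,ds$$ over vertical lines, directed upwards, on which the arguments of all Gamma functions in the numerator have positive real part. Then $\gamma$ has a probability density $f_\gamma$, the functions $x\mapsto\Gamma(p,q_kx)f_\gamma(x)$ are integrable on $(0,\infty)$, where $\Gamma(\cdot,\cdot)$ is the upper incomplete Gamma function, and the average bit-error rate $$P_e=\frac{\delta}{2\Gamma(p)}\sum_{k=1}^n\int_0^\infty\Gamma(p,q_kx)\,f_\gamma(x)\,dx$$ is given by $$\begin{aligned}P_e=\delta\sum_{k=1}^n\Big\{\frac12&-\frac{\omega_1\omega_2}{2\Gamma(p)}H\Big((0,r_1),(1,r_2);\,q_k\lambda_1^{r_1}\mu_1,\,\frac{C}{\lambda_2^{r_2}\mu_2}\Big)\\ &-\frac{\omega_1(1-\omega_2)}{2\Gamma(a_2)\Gamma(p)}H\Big((0,r_1),\big(a_2,\tfrac{r_2}{c_2}\big);\,q_k\lambda_1^{r_1}\mu_1,\,\frac{C}{b_2^{r_2}\mu_2}\Big)\\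 &-\frac{\omega_2(1-\omega_1)}{2\Gamma(a_1)\Gamma(p)}H\Big(\big(1-a_1,\tfrac{r_1}{c_1}\big),(1,r_2);\,q_kb_1^{r_1}\mu_1,\,\frac{C}{\lambda_2^{r_2}\mu_2}\Big)\\ &-\frac{(1-\omega_1)(1-\omega_2)}{2\Gamma(a_1)\Gamma(a_2)\Gamma(p)}H\Big(\big(1-a_1,\tfrac{r_1}{c_1}\big),\big(a_2,\tfrac{r_2}{c_2}\big);\,q_kb_1^{r_1}\mu_1,\,\frac{C}{b_2^{r_2}\mu_2}\Big)\Big\}.\end{aligned}$$ Moreover, for each of these four H-functions at these arguments, admissible pairs of lines exist, and the double integral converges absolutely over each of them with a value that does not depend on the choice. -/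

import Mathlib

open MeasureTheory ProbabilityTheory Set

noncomputable section

namespace UWOC

/-- The mixture Exponential-Generalized Gamma (EGG) density on `(0, ∞)`. -/
def eggPDF (ω lam a b c x : ℝ) : ℝ :=
  ω / lam * Real.exp (-(x / lam)) +
    (1 - ω) * (c * x ^ (a * c - 1) / (b ^ (a * c) * Real.Gamma a)) * Real.exp (-(x / b) ^ c)

/-- The EGG distribution, as a measure on `ℝ` concentrated on `(0, ∞)`. -/
def eggMeasure (ω lam a b c : ℝ) : Measure ℝ :=
  (volume.restrict (Ioi 0)).withDensity fun x => ENNReal.ofReal (eggPDF ω lam a b c x)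

/-- Instantaneous SNR `(η I) ^ r / N₀` of a hop with irradiance `I`
(`r = 1`: heterodyne detection, `r = 2`: IM/DD). -/
def hopSNR (η N₀ : ℝ) (r : ℕ) (I : ℝ) : ℝ := (η * I) ^ r / N₀

/-- Electrical SNR parameter of a hop: the SNR at unit (that is, normalized mean) irradiance. -/
def electricalSNR (η N₀ : ℝ) (r : ℕ) : ℝ := η ^ r / N₀

/-- End-to-end SNR of a dual-hop system with a fixed gain amplify-and-forward relay. -/
def endToEndSNR (C γ₁ γ₂ : ℝ) : ℝ := γ₁ * γ₂ / (γ₂ + C)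

/-- Upper incomplete Gamma function `Γ(p, x)`. -/
def upperGamma (p x : ℝ) : ℝ := ∫ t in Ioi x, t ^ (p - 1) * Real.exp (-t)

/-- The generalized average bit-error rate of an SNR with probability density `f` on `(0, ∞)`. -/
def averageBER {n : ℕ} (δ p : ℝ) (q : Fin n → ℝ) (f : ℝ → ℝ) : ℝ :=
  δ / (2 * Real.Gamma p) * ∑ k, ∫ x in Ioi 0, upperGamma p (q k * x) * f x

/-- Data of one of the two single-variable factors of a bivariate Fox H-function: the orders `m, n`,
the upper pairs `(c_j, γ_j)` and the lower pairs `(d_j, δ_j)`. The remaining two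
orders `p, q` are the lengths of the two lists. -/
structure FoxFactor where
  /-- number of lower pairs in the numerator -/
  m : ℕ
  /-- number of upper pairs in the numerator -/
  n : ℕ
  /-- upper pairs -/
  upper : List (ℝ × ℝ)
  /-- lower pairs -/
  lower : List (ℝ × ℝ)

/-- `∏_{j ≤ m} Γ(d_j - δ_j s) ∏_{j ≤ n} Γ(1 - c_j + γ_j s)` divided by
`∏_{j > m} Γ(1 - d_j + δ_j s) ∏_{j > n} Γ(c_j - γ_j s)`. -/
def FoxFactor.eval (F : FoxFactor) (s : ℂ) : ℂ :=
  ((F.lower.take F.m).map fun d => Complex.Gamma (d.1 - d.2 * s)).prod *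
      ((F.upper.take F.n).map fun c => Complex.Gamma (1 - c.1 + c.2 * s)).prod /
    (((F.lower.drop F.m).map fun d => Complex.Gamma (1 - d.1 + d.2 * s)).prod *
      ((F.upper.drop F.n).map fun c => Complex.Gamma (c.1 - c.2 * s)).prod)

/-- Data of a bivariate Fox H-function with orders `0, n : m₂, n₂ : m₃, n₃` (above) and
`p, q : p₂, q₂ : p₃, q₃` (below): the coupled upper triples `(a_j; α_j, A_j)`, `j ≤ p`, the
coupled lower triples `(b_j; β_j, B_j)`, `j ≤ q`, and the two single-variable factors. -/
structure FoxData where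
  /-- number of coupled upper triples in the numerator -/
  n : ℕ
  /-- coupled upper triples -/
  upper : List (ℝ × ℝ × ℝ)
  /-- coupled lower triples -/
  lower : List (ℝ × ℝ × ℝ)
  /-- factor in the first variable -/
  fst : FoxFactor
  /-- factor in the second variable -/
  snd : FoxFactor

namespace FoxData

/-- `∏_{j ≤ n} Γ(1 - a_j + α_j s + A_j t)` divided by
`∏_{j > n} Γ(a_j - α_j s - A_j t) ∏_j Γ(1 - b_j + β_j s + B_j t)`. -/
def coupled (D : FoxData) (s t : ℂ) : ℂ :=
  ((D.upper.take D.n).map fun a => Complex.Gamma (1 - a.1 + a.2.1 * s + a.2.2 * t)).prod /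
    (((D.upper.drop D.n).map fun a => Complex.Gamma (a.1 - a.2.1 * s - a.2.2 * t)).prod *
      (D.lower.map fun b => Complex.Gamma (1 - b.1 + b.2.1 * s + b.2.2 * t)).prod)

/-- The Mellin-Barnes integrand of the bivariate Fox H-function. -/
def integrand (D : FoxData) (x y : ℝ) (s t : ℂ) : ℂ :=
  D.coupled s t * D.fst.eval s * D.snd.eval t * (x : ℂ) ^ s * (y : ℂ) ^ t

/-- The vertical lines `Re s = σ`, `Re t = τ` are separating contours: every Gamma factor of the
numerator has an argument with positive real part there. For positive coefficients this means
that the poles of `Γ(d_j - δ_j s)` lie to the right of the contour and those of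
`Γ(1 - c_j + γ_j s)` and `Γ(1 - a_j + α_j s + A_j t)` to the left of it, and likewise for `t`. -/
def Separates (D : FoxData) (σ τ : ℝ) : Prop :=
  (∀ a ∈ D.upper.take D.n, 0 < 1 - a.1 + a.2.1 * σ + a.2.2 * τ) ∧
  (∀ d ∈ D.fst.lower.take D.fst.m, 0 < d.1 - d.2 * σ) ∧
  (∀ c ∈ D.fst.upper.take D.fst.n, 0 < 1 - c.1 + c.2 * σ) ∧
  (∀ d ∈ D.snd.lower.take D.snd.m, 0 < d.1 - d.2 * τ) ∧
  (∀ c ∈ D.snd.upper.take D.snd.n, 0 < 1 - c.1 + c.2 * τ)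

/-- The integrand on the contours, as a function of the two imaginary parts. -/
def lineIntegrand (D : FoxData) (x y σ τ : ℝ) (w : ℝ × ℝ) : ℂ :=
  D.integrand x y (σ + w.1 * Complex.I) (τ + w.2 * Complex.I)

/-- `(2πi)⁻² ∫∫ (integrand) ds dt` over `Re s = σ`, `Re t = τ`; here `ds dt = i² du dv`. -/
def contourIntegral (D : FoxData) (x y σ τ : ℝ) : ℂ :=
  1 / (2 * Real.pi * Complex.I) ^ 2 *
    (Complex.I ^ 2 * ∫ w : ℝ × ℝ, D.lineIntegrand x y σ τ w)

open Classical in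
/-- The bivariate Fox H-function: the double Mellin-Barnes integral over separating vertical
contours (`0` if there are none). -/
def foxH (D : FoxData) (x y : ℝ) : ℂ :=
  if h : ∃ c : ℝ × ℝ, D.Separates c.1 c.2 then
    D.contourIntegral x y h.choose.1 h.choose.2 else 0

/-- `D.foxH x y` is well defined: there are separating vertical contours, and over all of them the
double integral converges absolutely with the same value `D.foxH x y`. -/
def WellDefinedAt (D : FoxData) (x y : ℝ) : Prop :=
  (∃ σ τ : ℝ, D.Separates σ τ) ∧
  ∀ σ τ : ℝ, D.Separates σ τ →
    Integrable (D.lineIntegrand x y σ τ) ∧ D.contourIntegral x y σ τ = D.foxH x y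

end FoxData

/-- The data of
`H^{0,1:1,1:2,0}_{1,0:1,2:0,2}[(1;1,1); -- | u; (p,1)(0,1) | --; (0,1) v | ·, ·]`. -/
def berFox (p : ℝ) (u v : ℝ × ℝ) : FoxData where
  n := 1
  upper := [(1, 1, 1)]
  lower := []
  fst := { m := 1, n := 1, upper := [u], lower := [(p, 1), (0, 1)] }
  snd := { m := 2, n := 0, upper := [], lower := [(0, 1), v] }

end UWOC

end

noncomputable section

namespace UWOC


/-! Since `Γ(p, z) = Γ(p) - γ(p, z)`, averaging gives `Γ(p) - E[γ(p, q γ)]` for each `q`: the first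
term produces the `1/2`, and the lower incomplete Gamma function, which is bounded, produces the
H-functions. The exponential law is the generalized Gamma law with `a = c = 1`, so by independence
the expectation splits into four, one for each pair of mixture components. A generalized Gamma
variable is `b G ^ (1 / c)` with `G` Gamma distributed, and `γ₁ γ₂ / (γ₂ + C) = γ₁ / (1 + C / γ₂)`.
Each piece is therefore the mean of `γ(p, x G₁ ^ α / (1 + y G₂ ^ (-β)))`, up to normalization
`gammaExpectation`.

This mean is the H-function. Without fading, `γ(p, x / (1 + y))` is the double Mellin-Barnes
integral of `Γ(s+t) Γ(-t) Γ(p-s) / Γ(1+s) x^s y^t` (`integral_mellinBarnesKernel_mul_cpow`): the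
`t`-integral gives `Γ(s) (1 + y)^(-s)`, and `Γ(s) / Γ(1+s) = 1/s` leaves the Mellin-Barnes integral
of `γ(p, ·)`. Replacing `x, y` by `x G₁ ^ α, y G₂ ^ (-β)` and averaging under the integral inserts
the moments `Γ(a₁ + α s)` and `Γ(a₂ - β t)` (`integral_kernel_mul_Gamma_mul_Gamma`).

Fubini rests on `integrable_mellinBarnesKernel`: `Γ(p-s) / Γ(1+s)` grows at most polynomially, while
`Γ(s+t)` and `Γ(-t)` decay faster than any power. The resulting expectation does not mention the
lines, so independence of the contour needs no contour shift. -/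

/-! ### Bounds for Gamma on vertical lines -/

theorem norm_Gamma_le {s : ℂ} (hs : 0 < s.re) : ‖Complex.Gamma s‖ ≤ Real.Gamma s.re := by
  rw [Complex.Gamma_eq_integral hs, Complex.GammaIntegral, Real.Gamma_eq_integral hs]
  refine (norm_integral_le_integral_norm _).trans_eq ?_
  refine setIntegral_congr_fun measurableSet_Ioi fun t ht => ?_
  simp only [norm_mul, Complex.norm_real, Complex.norm_cpow_eq_rpow_re_of_pos ht, Real.norm_eq_abs,
    abs_of_pos (Real.exp_pos _)]
  simp

theorem one_add_abs_le_norm {c : ℝ} (hc : 0 < c) (v : ℝ) :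
    1 + |v| ≤ (1 / c + 1) * ‖(c : ℂ) + v * Complex.I‖ := by
  have h1 : c ≤ ‖(c : ℂ) + v * Complex.I‖ := by
    have := Complex.abs_re_le_norm ((c : ℂ) + v * Complex.I)
    simp at this
    exact (le_abs_self c).trans this
  have h2 : |v| ≤ ‖(c : ℂ) + v * Complex.I‖ := by
    have := Complex.abs_im_le_norm ((c : ℂ) + v * Complex.I)
    simpa using this
  have h3 : 1 ≤ 1 / c * ‖(c : ℂ) + v * Complex.I‖ := by
    rw [one_div_mul_eq_div, one_le_div hc]; exact h1
  linarith

/-- On a vertical line in the right half-plane, Gamma decays faster than any power. -/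
theorem exists_norm_Gamma_mul_pow_le (N : ℕ) : ∀ {c : ℝ}, 0 < c →
    ∃ A : ℝ, 0 ≤ A ∧ ∀ v : ℝ, ‖Complex.Gamma (c + v * Complex.I)‖ * (1 + |v|) ^ N ≤ A := by
  induction N with
  | zero =>
    intro c hc
    refine ⟨Real.Gamma c, (Real.Gamma_pos_of_pos hc).le, fun v => ?_⟩
    have := norm_Gamma_le (s := c + v * Complex.I) (by simpa using hc)
    simpa using this
  | succ N ih =>
    intro c hc
    -- `Γ(s+1) = s Γ(s)` and `|s|` is at least a constant times `1 + |v|`, so moving one unit to the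
    -- right buys one power.
    obtain ⟨A, hA, h⟩ := ih (c := c + 1) (by linarith)
    refine ⟨(1 / c + 1) * A, by positivity, fun v => ?_⟩
    have h0 : (c : ℂ) + v * Complex.I ≠ 0 := by
      intro h; apply hc.ne'; simpa using congrArg Complex.re h
    have e : ((c + 1 : ℝ) : ℂ) + v * Complex.I = (c + v * Complex.I) + 1 := by push_cast; ring
    have h1 := h v
    rw [e, Complex.Gamma_add_one _ h0, norm_mul] at h1
    calc _ = ‖Complex.Gamma (c + v * Complex.I)‖ * (1 + |v|) ^ N * (1 + |v|) := by ring
      _ ≤ ‖Complex.Gamma (c + v * Complex.I)‖ * (1 + |v|) ^ N *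
          ((1 / c + 1) * ‖(c : ℂ) + v * Complex.I‖) := by
        gcongr; exact one_add_abs_le_norm hc v
      _ = (1 / c + 1) * (‖(c : ℂ) + v * Complex.I‖ * ‖Complex.Gamma (c + v * Complex.I)‖ *
          (1 + |v|) ^ N) := by ring
      _ ≤ _ := by gcongr

theorem norm_Gamma_add_nat_le {y : ℝ} (hy : 0 < y) (n : ℕ) : ∃ A : ℝ, 0 ≤ A ∧ ∀ u : ℝ,
    ‖Complex.Gamma ((y + n : ℝ) + u * Complex.I)‖ ≤
      A * (1 + |u|) ^ n * ‖Complex.Gamma (y + u * Complex.I)‖ := by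
  induction n with
  | zero => exact ⟨1, zero_le_one, fun u => by simp⟩
  | succ n ih =>
    obtain ⟨A, hA, h⟩ := ih
    refine ⟨(y + n + 1) * A, by positivity, fun u => ?_⟩
    have h0 : ((y + n : ℝ) : ℂ) + u * Complex.I ≠ 0 := by
      intro h; have := congrArg Complex.re h; simp at this
      have : (0 : ℝ) ≤ n := by positivity
      linarith
    have e : ((y + (n + 1 : ℕ) : ℝ) : ℂ) + u * Complex.I =
      ((y + n : ℝ) + u * Complex.I) + 1 := by push_cast; ring
    rw [e, Complex.Gamma_add_one _ h0, norm_mul]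
    have h2 : ‖((y + n : ℝ) : ℂ) + u * Complex.I‖ ≤ (y + n + 1) * (1 + |u|) := by
      refine (norm_add_le _ _).trans ?_
      rw [Complex.norm_real, norm_mul, Complex.norm_real, Complex.norm_I, Real.norm_eq_abs,
        Real.norm_eq_abs, abs_of_nonneg (by positivity)]
      have : 0 ≤ (y + n) * |u| := by positivity
      nlinarith
    calc _ ≤ ((y + n + 1) * (1 + |u|)) * (A * (1 + |u|) ^ n * ‖Complex.Gamma (y + u * Complex.I)‖) :=
          mul_le_mul h2 (h u) (norm_nonneg _) (by positivity)
      _ = _ := by ring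

theorem norm_betaIntegral_le {x d : ℝ} (u : ℝ) :
    ‖Complex.betaIntegral (x + u * Complex.I) d‖ ≤
      ∫ t in (0 : ℝ)..1, t ^ (x - 1) * (1 - t) ^ (d - 1) := by
  rw [Complex.betaIntegral]
  refine (intervalIntegral.norm_integral_le_integral_norm zero_le_one).trans_eq ?_
  rw [intervalIntegral.integral_of_le zero_le_one, intervalIntegral.integral_of_le zero_le_one,
    integral_Ioc_eq_integral_Ioo, integral_Ioc_eq_integral_Ioo]
  refine setIntegral_congr_fun measurableSet_Ioo fun t ht => ?_
  have h1 : (1 - (t : ℂ)) = ((1 - t : ℝ) : ℂ) := by push_cast; rfl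
  simp only [norm_mul, h1, Complex.norm_cpow_eq_rpow_re_of_pos ht.1,
    Complex.norm_cpow_eq_rpow_re_of_pos (sub_pos.2 ht.2)]
  simp

/-- The ratio of two Gamma functions on vertical lines grows at most polynomially. -/
theorem exists_norm_Gamma_le_mul_pow {x y : ℝ} (hx : 0 < x) (hy : 0 < y) :
    ∃ (A : ℝ) (n : ℕ), 0 ≤ A ∧ ∀ u : ℝ, ‖Complex.Gamma (x + u * Complex.I)‖ ≤
      A * (1 + |u|) ^ n * ‖Complex.Gamma (y + u * Complex.I)‖ := by
  -- With `d = y + n - x > 0`, the Beta identity gives `Γ(x+iu) Γ(d) = Γ(y+n+iu) B(x+iu, d)`. The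
  -- Beta factor is bounded uniformly in `u`, and `Γ(y+n+iu)` is a degree `n` polynomial times
  -- `Γ(y+iu)`.
  obtain ⟨n, hn⟩ := exists_nat_gt x
  obtain ⟨A, hA, h⟩ := norm_Gamma_add_nat_le hy n
  set d : ℝ := y + n - x with hd
  have hd0 : 0 < d := by linarith
  set B : ℝ := ∫ t in (0 : ℝ)..1, t ^ (x - 1) * (1 - t) ^ (d - 1) with hB
  have hB0 : 0 ≤ B := (norm_nonneg _).trans (norm_betaIntegral_le 0)
  have hG : 0 < Real.Gamma d := Real.Gamma_pos_of_pos hd0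
  refine ⟨B * A / Real.Gamma d, n, by positivity, fun u => ?_⟩
  have h1 := Complex.Gamma_mul_Gamma_eq_betaIntegral (s := x + u * Complex.I) (t := (d : ℂ))
    (by simpa using hx) (by simpa using hd0)
  have e : (x : ℂ) + u * Complex.I + d = ((y + n : ℝ) : ℂ) + u * Complex.I := by
    rw [hd]; push_cast; ring
  rw [e] at h1
  have h2 := congrArg norm h1
  rw [norm_mul, norm_mul, Complex.Gamma_ofReal, Complex.norm_real, Real.norm_eq_abs,
    abs_of_pos hG] at h2
  have h3 : ‖Complex.Gamma (x + u * Complex.I)‖ * Real.Gamma d ≤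
      A * (1 + |u|) ^ n * ‖Complex.Gamma (y + u * Complex.I)‖ * B := by
    rw [h2]
    exact mul_le_mul (h u) (norm_betaIntegral_le u) (norm_nonneg _) (by positivity)
  rw [← le_div_iff₀ hG] at h3
  refine h3.trans_eq ?_
  ring

theorem continuous_Gamma_comp {X : Type*} [TopologicalSpace X] {f : X → ℂ} (hf : Continuous f)
    (h : ∀ x, 0 < (f x).re) : Continuous fun x => Complex.Gamma (f x) := by
  refine continuous_iff_continuousAt.2 fun x => ?_
  refine (Complex.continuousAt_Gamma (f x) fun m hm => ?_).comp hf.continuousAt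
  have h1 := h x
  rw [hm] at h1
  simp at h1
  have : (0 : ℝ) ≤ m := by positivity
  linarith

theorem integrable_inv_one_add_abs_sq : Integrable fun v : ℝ => ((1 + |v|) ^ 2)⁻¹ := by
  refine integrable_inv_one_add_sq.mono' (by fun_prop (disch := intros; positivity)) ?_
  refine Filter.Eventually.of_forall fun v => ?_
  rw [Real.norm_eq_abs, abs_of_nonneg (by positivity)]
  refine inv_anti₀ (by positivity) ?_
  nlinarith [sq_abs v, abs_nonneg v]

theorem integrable_Gamma_line {c : ℝ} (hc : 0 < c) :
    Integrable fun v : ℝ => Complex.Gamma (c + v * Complex.I) := by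
  obtain ⟨A, hA, h⟩ := exists_norm_Gamma_mul_pow_le 2 hc
  refine (integrable_inv_one_add_abs_sq.const_mul A).mono'
    (continuous_Gamma_comp (by fun_prop) (fun _ => by simpa using hc)).aestronglyMeasurable ?_
  refine Filter.Eventually.of_forall fun v => ?_
  rw [← div_eq_mul_inv, le_div_iff₀ (by positivity)]
  exact h v


/-! ### One-variable Mellin-Barnes integrals -/

/-- Fubini in the form used throughout: on a vertical line the modulus of `z ^ s` depends only on
`Re s`, so the integrand is dominated by a product of one function of `w` and one of `z`. -/
theorem integral_mul_integral_swap {W Z : Type*} [MeasurableSpace W] [MeasurableSpace Z]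
    {μ : Measure W} {ν : Measure Z} [SFinite μ] [SFinite ν] {K : W → ℂ} {φ : W → Z → ℂ}
    {ψ : Z → ℝ} (hK : Integrable K μ) (hψ : Integrable ψ ν)
    (hφ : AEStronglyMeasurable (Function.uncurry φ) (μ.prod ν))
    (hb : ∀ᵐ z ∂ν, ∀ w, ‖φ w z‖ ≤ ψ z) :
    ∫ w, K w * ∫ z, φ w z ∂ν ∂μ = ∫ z, ∫ w, K w * φ w z ∂μ ∂ν := by
  have hint : Integrable (Function.uncurry fun w z => K w * φ w z) (μ.prod ν) := by
    refine (hK.norm.mul_prod hψ).mono' ?_ ?_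
    · exact hK.aestronglyMeasurable.comp_fst.mul hφ
    · filter_upwards [Measure.quasiMeasurePreserving_snd.ae hb] with q hq
      simp only [Function.uncurry, norm_mul]
      gcongr
      exact hq q.1
  rw [← integral_integral_swap hint]
  simp_rw [integral_const_mul]

/-- The lower incomplete Gamma function `γ(p, x)`. -/
def lowerGamma (p x : ℝ) : ℝ := ∫ t in Ioc 0 x, t ^ (p - 1) * Real.exp (-t)

/-- Mellin inversion of `exp (-x)`, whose Mellin transform is Gamma, after reflecting the line by `t
↦ -t`. -/
theorem integral_Gamma_neg_mul_cpow {τ : ℝ} (hτ : τ < 0) {x : ℝ} (hx : 0 < x) :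
    ∫ v : ℝ, Complex.Gamma (-(τ + v * Complex.I)) * (x : ℂ) ^ ((τ : ℂ) + v * Complex.I) =
      2 * Real.pi * Real.exp (-x) := by
  have hG : ∀ y : ℝ, mellin (fun x : ℝ => ((Real.exp (-x) : ℝ) : ℂ)) (((-τ : ℝ) : ℂ) + y * Complex.I) =
      Complex.Gamma (((-τ : ℝ) : ℂ) + y * Complex.I) := fun y => by
    rw [← Complex.GammaIntegral_eq_mellin, Complex.Gamma_eq_integral (by simpa using hτ)]
  have h := mellinInv_mellin_eq (-τ) (fun x : ℝ => ((Real.exp (-x) : ℝ) : ℂ)) hx ?_ ?_ ?_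
  · rw [mellinInv] at h
    simp_rw [hG] at h
    rw [← integral_neg_eq_self]
    have hpi : (Real.pi : ℂ) ≠ 0 := by exact_mod_cast Real.pi_ne_zero
    rw [← h, Complex.real_smul]
    push_cast
    field_simp
    refine integral_congr_ae (Filter.Eventually.of_forall fun v => ?_)
    simp only [smul_eq_mul]
    rw [mul_comm]
    congr 2 <;> ring
  · rw [MellinConvergent]
    have := Complex.GammaIntegral_convergent (s := ((-τ : ℝ) : ℂ)) (by simpa using hτ)
    refine this.congr_fun (fun t _ => ?_) measurableSet_Ioi
    simp [mul_comm]
  · rw [Complex.VerticalIntegrable]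
    simp_rw [hG]
    exact integrable_Gamma_line (by linarith)
  · fun_prop

theorem integrable_Gamma_neg_line {τ : ℝ} (hτ : τ < 0) :
    Integrable fun v : ℝ => Complex.Gamma (-(τ + v * Complex.I)) := by
  have := (integrable_Gamma_line (c := -τ) (by linarith)).comp_neg
  refine this.congr (Filter.Eventually.of_forall fun v => ?_)
  simp only
  congr 1; push_cast; ring

theorem norm_cpow_line {x : ℝ} (hx : 0 < x) (σ u : ℝ) :
    ‖(x : ℂ) ^ ((σ : ℂ) + u * Complex.I)‖ = x ^ σ := by
  rw [Complex.norm_cpow_eq_rpow_re_of_pos hx]; simp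

theorem continuous_cpow_comp {X : Type*} [TopologicalSpace X] {x : ℝ} (hx : 0 < x)
    {f : X → ℂ} (hf : Continuous f) : Continuous fun u => (x : ℂ) ^ f u := by
  refine hf.const_cpow (Or.inl ?_)
  exact_mod_cast hx.ne'

theorem integrable_mul_cpow_line {K : ℝ → ℂ} (hK : Integrable K) {x : ℝ} (hx : 0 < x) (σ : ℝ) :
    Integrable fun u : ℝ => K u * (x : ℂ) ^ ((σ : ℂ) + u * Complex.I) := by
  refine hK.mul_bdd (c := x ^ σ)
    (continuous_cpow_comp hx (by fun_prop)).aestronglyMeasurable ?_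
  exact Filter.Eventually.of_forall fun u => (norm_cpow_line hx σ u).le

/-- The Mellin-Barnes integral of `(1 + Y) ^ (-s)`. -/
theorem integral_Gamma_add_mul_Gamma_neg_mul_cpow {s : ℂ} {τ Y : ℝ} (hτ : τ < 0)
    (hs : 0 < s.re + τ) (hY : 0 < Y) :
    ∫ v : ℝ, Complex.Gamma (s + (τ + v * Complex.I)) * Complex.Gamma (-(τ + v * Complex.I)) *
      (Y : ℂ) ^ ((τ : ℂ) + v * Complex.I) =
      2 * Real.pi * (Complex.Gamma s * ((1 / (1 + Y) : ℝ) : ℂ) ^ s) := by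
  -- Expand `Γ(s+t)` as an Euler integral over `z` and swap: the inner integral over `t` is `exp (-Y
  -- z)`, which leaves an Euler integral with `exp (-(1 + Y) z)`.
  have key := integral_mul_integral_swap (μ := volume) (ν := volume.restrict (Ioi (0 : ℝ)))
    (K := fun v : ℝ => Complex.Gamma (-(τ + v * Complex.I)) * (Y : ℂ) ^ ((τ : ℂ) + v * Complex.I))
    (φ := fun v z => ((Real.exp (-z) : ℝ) : ℂ) * (z : ℂ) ^ (s + (τ + v * Complex.I) - 1))
    (ψ := fun z => Real.exp (-z) * z ^ (s.re + τ - 1))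
    (integrable_mul_cpow_line (integrable_Gamma_neg_line hτ) hY τ)
    (Real.GammaIntegral_convergent hs) (by
      refine Measurable.aestronglyMeasurable ?_
      simp only [Function.uncurry_def]
      fun_prop) (by
      filter_upwards [ae_restrict_mem measurableSet_Ioi] with z hz w
      rw [norm_mul, Complex.norm_real, Real.norm_eq_abs, abs_of_pos (Real.exp_pos _),
        Complex.norm_cpow_eq_rpow_re_of_pos hz]
      simp)
  have hl : ∀ v : ℝ, Complex.Gamma (s + (τ + v * Complex.I)) =
      ∫ z in Ioi (0 : ℝ), ((Real.exp (-z) : ℝ) : ℂ) * (z : ℂ) ^ (s + (τ + v * Complex.I) - 1) :=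
    fun v => by
      rw [Complex.Gamma_eq_integral (by simpa using hs)]; rfl
  have hL : ∀ v : ℝ, Complex.Gamma (s + (τ + v * Complex.I)) *
      Complex.Gamma (-(τ + v * Complex.I)) * (Y : ℂ) ^ ((τ : ℂ) + v * Complex.I) =
      (Complex.Gamma (-(τ + v * Complex.I)) * (Y : ℂ) ^ ((τ : ℂ) + v * Complex.I)) *
      ∫ z in Ioi (0 : ℝ), ((Real.exp (-z) : ℝ) : ℂ) * (z : ℂ) ^ (s + (τ + v * Complex.I) - 1) :=
    fun v => by rw [← hl]; ring
  simp_rw [hL]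
  rw [key]
  have hs0 : 0 < s.re := by linarith
  have h1Y : 0 < 1 + Y := by linarith
  have hfin := Complex.integral_cpow_mul_exp_neg_mul_Ioi hs0 h1Y
  have hcast : ((1 / (1 + Y) : ℝ) : ℂ) = 1 / ((1 + Y : ℝ) : ℂ) := by push_cast; rfl
  rw [hcast, mul_comm (Complex.Gamma s), ← hfin, ← integral_const_mul]
  refine setIntegral_congr_fun measurableSet_Ioi fun z (hz : 0 < z) => ?_
  have hz0 : (z : ℂ) ≠ 0 := by exact_mod_cast hz.ne'
  have e : ∀ v : ℝ, Complex.Gamma (-(τ + v * Complex.I)) * (Y : ℂ) ^ ((τ : ℂ) + v * Complex.I) *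
      (((Real.exp (-z) : ℝ) : ℂ) * (z : ℂ) ^ (s + (τ + v * Complex.I) - 1)) =
      (((Real.exp (-z) : ℝ) : ℂ) * (z : ℂ) ^ (s - 1)) *
      (Complex.Gamma (-(τ + v * Complex.I)) * ((Y * z : ℝ) : ℂ) ^ ((τ : ℂ) + v * Complex.I)) :=
    fun v => by
      rw [Complex.ofReal_mul, Complex.mul_cpow_ofReal_nonneg hY.le hz.le,
        show s + (τ + v * Complex.I) - 1 = (s - 1) + (τ + v * Complex.I) by ring,
        Complex.cpow_add _ _ hz0]
      ring
  simp_rw [e]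
  rw [integral_const_mul, integral_Gamma_neg_mul_cpow hτ (by positivity)]
  have : Complex.exp (-(((1 + Y : ℝ) : ℂ) * z)) =
      ((Real.exp (-z) : ℝ) : ℂ) * ((Real.exp (-(Y * z)) : ℝ) : ℂ) := by
    rw [Complex.ofReal_exp, Complex.ofReal_exp, ← Complex.exp_add]
    congr 1; push_cast; ring
  rw [this]
  ring

/-- The Mellin-Barnes integral of the lower incomplete Gamma function. -/
theorem integral_Gamma_sub_div_mul_cpow {p σ z : ℝ} (hσ : 0 < σ) (hσp : σ < p) (hz : 0 < z) :
    ∫ u : ℝ, Complex.Gamma (p - (σ + u * Complex.I)) / (σ + u * Complex.I) *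
      (z : ℂ) ^ ((σ : ℂ) + u * Complex.I) = 2 * Real.pi * lowerGamma p z := by
  have hK : Integrable fun u : ℝ => Complex.Gamma (p - (σ + u * Complex.I)) := by
    refine (integrable_Gamma_neg_line (τ := σ - p) (by linarith)).congr
      (Filter.Eventually.of_forall fun v => ?_)
    simp only
    congr 1; push_cast; ring
  -- Write `1/s` as the integral of `w ^ (s - 1)` over `(0, 1]` and swap.
  have key := integral_mul_integral_swap (μ := volume) (ν := volume.restrict (Ioc (0 : ℝ) 1))
    (K := fun u : ℝ => Complex.Gamma (p - (σ + u * Complex.I)) * (z : ℂ) ^ ((σ : ℂ) + u * Complex.I))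
    (φ := fun u w => (w : ℂ) ^ ((σ : ℂ) + u * Complex.I - 1))
    (ψ := fun w => w ^ (σ - 1))
    (integrable_mul_cpow_line hK hz σ)
    ((intervalIntegrable_iff_integrableOn_Ioc_of_le zero_le_one).1
      (intervalIntegral.intervalIntegrable_rpow' (by linarith))) (by
      refine Measurable.aestronglyMeasurable ?_
      simp only [Function.uncurry_def]
      fun_prop) (by
      filter_upwards [ae_restrict_mem measurableSet_Ioc] with w hw u
      rw [Complex.norm_cpow_eq_rpow_re_of_pos hw.1]
      simp)
  have hφ : ∀ u : ℝ, ∫ w in Ioc (0 : ℝ) 1, (w : ℂ) ^ ((σ : ℂ) + u * Complex.I - 1) =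
      1 / (σ + u * Complex.I) := fun u => by
    have h0 : (σ : ℂ) + u * Complex.I ≠ 0 := by
      intro h; apply hσ.ne'; simpa using congrArg Complex.re h
    rw [← intervalIntegral.integral_of_le zero_le_one, integral_cpow (Or.inl (by simpa using hσ))]
    simp [h0]
  have hL : ∀ u : ℝ, Complex.Gamma (p - (σ + u * Complex.I)) / (σ + u * Complex.I) *
      (z : ℂ) ^ ((σ : ℂ) + u * Complex.I) =
      Complex.Gamma (p - (σ + u * Complex.I)) * (z : ℂ) ^ ((σ : ℂ) + u * Complex.I) *
      ∫ w in Ioc (0 : ℝ) 1, (w : ℂ) ^ ((σ : ℂ) + u * Complex.I - 1) := fun u => by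
    rw [hφ]; ring
  simp_rw [hL]
  rw [key]
  have hlow : lowerGamma p z =
      ∫ w in Ioc (0 : ℝ) 1, z * ((z * w) ^ (p - 1) * Real.exp (-(z * w))) := by
    rw [lowerGamma, ← intervalIntegral.integral_of_le hz.le,
      ← intervalIntegral.integral_of_le zero_le_one, intervalIntegral.integral_const_mul]
    have := intervalIntegral.mul_integral_comp_mul_left (a := 0) (b := 1)
      (f := fun t : ℝ => t ^ (p - 1) * Real.exp (-t)) z
    rw [this]; simp
  rw [hlow, ← integral_complex_ofReal, ← integral_const_mul]
  refine setIntegral_congr_fun measurableSet_Ioc fun w hw => ?_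
  have hw0 : (w : ℂ) ≠ 0 := by exact_mod_cast hw.1.ne'
  have hzw : 0 < z * w := mul_pos hz hw.1
  have hzw0 : ((z * w : ℝ) : ℂ) ≠ 0 := by exact_mod_cast hzw.ne'
  -- Splitting off `(z w) ^ p` moves the line to `Re = σ - p < 0`, where the inversion formula for
  -- `exp (-z w)` applies.
  have e : ∀ u : ℝ, Complex.Gamma (p - (σ + u * Complex.I)) * (z : ℂ) ^ ((σ : ℂ) + u * Complex.I) *
      (w : ℂ) ^ ((σ : ℂ) + u * Complex.I - 1) =
      ((w : ℂ)⁻¹ * ((z * w : ℝ) : ℂ) ^ (p : ℂ)) *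
      (Complex.Gamma (-(((σ - p : ℝ) : ℂ) + u * Complex.I)) *
        ((z * w : ℝ) : ℂ) ^ (((σ - p : ℝ) : ℂ) + u * Complex.I)) := fun u => by
    have h1 : ((z * w : ℝ) : ℂ) ^ (p : ℂ) * ((z * w : ℝ) : ℂ) ^ (((σ - p : ℝ) : ℂ) + u * Complex.I) =
        (z : ℂ) ^ ((σ : ℂ) + u * Complex.I) * (w : ℂ) ^ ((σ : ℂ) + u * Complex.I) := by
      rw [← Complex.cpow_add _ _ hzw0, Complex.ofReal_mul,
        ← Complex.mul_cpow_ofReal_nonneg hz.le hw.1.le]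
      congr 1; push_cast; ring
    rw [Complex.cpow_sub _ _ hw0, Complex.cpow_one,
      show -(((σ - p : ℝ) : ℂ) + u * Complex.I) = p - (σ + u * Complex.I) by push_cast; ring]
    linear_combination (-(w : ℂ)⁻¹ * Complex.Gamma (p - (σ + u * Complex.I))) * h1
  simp_rw [e]
  rw [integral_const_mul, integral_Gamma_neg_mul_cpow (by linarith) hzw,
    ← Complex.ofReal_cpow hzw.le]
  have h2 : (z * w) ^ p = (z * w) ^ (p - 1) * (z * w) := by
    rw [Real.rpow_sub_one hzw.ne', div_mul_cancel₀ _ hzw.ne']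
  rw [h2]
  push_cast
  field_simp


/-! ### The double Mellin-Barnes integral and its Gamma averages -/

/-- The part of the Mellin-Barnes integrand that does not depend on the fading parameters. -/
def mellinBarnesKernel (p : ℝ) (s t : ℂ) : ℂ :=
  Complex.Gamma (s + t) * Complex.Gamma (-t) * (Complex.Gamma (p - s) / Complex.Gamma (1 + s))

/-- Turns decay in `u + v` and in `v`, which the kernel has, into decay in `u`. -/
theorem one_add_abs_le_mul (u v : ℝ) : 1 + |u| ≤ (1 + |u + v|) * (1 + |v|) := by
  have h : |u| ≤ |u + v| + |v| := by
    have := abs_sub (u + v) v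
    rwa [add_sub_cancel_right] at this
  nlinarith [abs_nonneg (u + v), abs_nonneg v, mul_nonneg (abs_nonneg (u + v)) (abs_nonneg v)]

theorem continuous_mellinBarnesKernel {p σ τ : ℝ} (hτ : τ < 0) (hστ : 0 < σ + τ) (hσp : σ < p) :
    Continuous fun w : ℝ × ℝ =>
      mellinBarnesKernel p (σ + w.1 * Complex.I) (τ + w.2 * Complex.I) := by
  unfold mellinBarnesKernel
  refine ((continuous_Gamma_comp (by fun_prop) fun w => ?_).mul
    (continuous_Gamma_comp (by fun_prop) fun w => ?_)).mul
    ((continuous_Gamma_comp (by fun_prop) fun w => ?_).div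
      (continuous_Gamma_comp (by fun_prop) fun w => ?_) fun w => ?_)
  · simpa using hστ
  · simpa using hτ
  · simpa using hσp
  · simp; linarith
  · refine Complex.Gamma_ne_zero_of_re_pos ?_
    simp; linarith

theorem integrable_mellinBarnesKernel {p σ τ : ℝ} (hτ : τ < 0) (hστ : 0 < σ + τ) (hσp : σ < p) :
    Integrable fun w : ℝ × ℝ =>
      mellinBarnesKernel p (σ + w.1 * Complex.I) (τ + w.2 * Complex.I) := by
  obtain ⟨A, n, hA, hr⟩ := exists_norm_Gamma_le_mul_pow (x := p - σ) (y := 1 + σ) (by linarith)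
    (by linarith)
  -- Of the `n + 2` powers, `n` absorb the growth of the Gamma ratio and two make the `u`-integral
  -- converge. Trading `u + v` for `u` costs `n + 2` powers of `1 + |v|`, and two more give
  -- convergence in `v`.
  obtain ⟨B, hB, hsum⟩ := exists_norm_Gamma_mul_pow_le (n + 2) hστ
  obtain ⟨D, hD, hneg⟩ := exists_norm_Gamma_mul_pow_le (n + 4) (c := -τ) (by linarith)
  have hI := (integrable_inv_one_add_abs_sq.mul_prod integrable_inv_one_add_abs_sq).const_mul
    (A * B * D)
  refine hI.mono' (continuous_mellinBarnesKernel hτ hστ hσp).aestronglyMeasurable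
    (Filter.Eventually.of_forall fun ⟨u, v⟩ => ?_)
  simp only [mellinBarnesKernel, norm_mul, norm_div]
  have h1 := hsum (u + v)
  have h2 := hneg (-v)
  have h3 := hr (-u)
  rw [abs_neg] at h2 h3
  have e1 : ((σ + τ : ℝ) : ℂ) + ((u + v : ℝ) : ℂ) * Complex.I =
    σ + u * Complex.I + (τ + v * Complex.I) := by push_cast; ring
  have e2 : ((-τ : ℝ) : ℂ) + ((-v : ℝ) : ℂ) * Complex.I = -(τ + v * Complex.I) := by
    push_cast; ring
  have e3 : ((p - σ : ℝ) : ℂ) + ((-u : ℝ) : ℂ) * Complex.I = p - (σ + u * Complex.I) := by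
    push_cast; ring
  -- The ratio bound compares equal imaginary parts, but `p - s` and `1 + s` have opposite ones;
  -- conjugation preserves the norm.
  have e4 : ‖Complex.Gamma (((1 + σ : ℝ) : ℂ) + ((-u : ℝ) : ℂ) * Complex.I)‖ =
      ‖Complex.Gamma (1 + (σ + u * Complex.I))‖ := by
    rw [← Complex.norm_conj, ← Complex.Gamma_conj]
    congr 2; simp; ring
  rw [e1] at h1
  rw [e2] at h2
  rw [e3, e4] at h3
  have hpos : 0 < ‖Complex.Gamma (1 + (σ + u * Complex.I))‖ := by
    rw [norm_pos_iff]
    refine Complex.Gamma_ne_zero_of_re_pos ?_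
    simp; linarith
  rw [← div_le_iff₀ hpos] at h3
  set a := ‖Complex.Gamma (σ + u * Complex.I + (τ + v * Complex.I))‖
  set b := ‖Complex.Gamma (-(τ + v * Complex.I))‖
  set r := ‖Complex.Gamma (p - (σ + u * Complex.I))‖ / ‖Complex.Gamma (1 + (σ + u * Complex.I))‖
  have ha : 0 ≤ a := norm_nonneg _
  have hb : 0 ≤ b := norm_nonneg _
  have hkey : a * b * ((1 + |u|) ^ (n + 2) * (1 + |v|) ^ 2) ≤ B * D := by
    calc a * b * ((1 + |u|) ^ (n + 2) * (1 + |v|) ^ 2)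
        ≤ a * b * (((1 + |u + v|) * (1 + |v|)) ^ (n + 2) * (1 + |v|) ^ 2) := by
          gcongr; exact one_add_abs_le_mul u v
      _ = (a * (1 + |u + v|) ^ (n + 2)) * (b * (1 + |v|) ^ (n + 4)) := by
        rw [mul_pow]; ring
      _ ≤ B * D := by gcongr
  have hu : 0 < 1 + |u| := by positivity
  have hv : 0 < 1 + |v| := by positivity
  calc a * b * r ≤ a * b * (A * (1 + |u|) ^ n) := by gcongr
    _ = A * (a * b * ((1 + |u|) ^ (n + 2) * (1 + |v|) ^ 2)) *
        (((1 + |u|) ^ 2)⁻¹ * ((1 + |v|) ^ 2)⁻¹) := by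
        field_simp
        ring
    _ ≤ A * (B * D) * (((1 + |u|) ^ 2)⁻¹ * ((1 + |v|) ^ 2)⁻¹) := by gcongr
    _ = _ := by ring

theorem integrable_mellinBarnesKernel_mul_cpow {p σ τ x y : ℝ} (hτ : τ < 0) (hστ : 0 < σ + τ)
    (hσp : σ < p) (hx : 0 < x) (hy : 0 < y) :
    Integrable fun w : ℝ × ℝ =>
      mellinBarnesKernel p (σ + w.1 * Complex.I) (τ + w.2 * Complex.I) *
        ((x : ℂ) ^ ((σ : ℂ) + w.1 * Complex.I) * (y : ℂ) ^ ((τ : ℂ) + w.2 * Complex.I)) := by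
  refine (integrable_mellinBarnesKernel hτ hστ hσp).mul_bdd (c := x ^ σ * y ^ τ)
    ((continuous_cpow_comp hx (by fun_prop)).mul
      (continuous_cpow_comp hy (by fun_prop))).aestronglyMeasurable ?_
  refine Filter.Eventually.of_forall fun w => ?_
  rw [norm_mul, norm_cpow_line hx, norm_cpow_line hy]

theorem integral_mellinBarnesKernel_mul_cpow {p σ τ x y : ℝ} (hτ : τ < 0) (hστ : 0 < σ + τ)
    (hσp : σ < p) (hx : 0 < x) (hy : 0 < y) :
    ∫ w : ℝ × ℝ, mellinBarnesKernel p (σ + w.1 * Complex.I) (τ + w.2 * Complex.I) *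
        ((x : ℂ) ^ ((σ : ℂ) + w.1 * Complex.I) * (y : ℂ) ^ ((τ : ℂ) + w.2 * Complex.I)) =
      (2 * Real.pi) ^ 2 * lowerGamma p (x / (1 + y)) := by
  have hσ : 0 < σ := by linarith
  have hI := integrable_mellinBarnesKernel_mul_cpow hτ hστ hσp hx hy
  rw [Measure.volume_eq_prod] at hI ⊢
  rw [integral_prod _ hI]
  have h1y : 0 < 1 / (1 + y) := by positivity
  have inner : ∀ u : ℝ, ∫ v : ℝ, mellinBarnesKernel p (σ + u * Complex.I) (τ + v * Complex.I) *
        ((x : ℂ) ^ ((σ : ℂ) + u * Complex.I) * (y : ℂ) ^ ((τ : ℂ) + v * Complex.I)) =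
      2 * Real.pi * (Complex.Gamma (p - (σ + u * Complex.I)) / (σ + u * Complex.I) *
        ((x / (1 + y) : ℝ) : ℂ) ^ ((σ : ℂ) + u * Complex.I)) := fun u => by
    have hs0 : (σ : ℂ) + u * Complex.I ≠ 0 := by
      intro h; apply hσ.ne'; simpa using congrArg Complex.re h
    have hG : Complex.Gamma (σ + u * Complex.I) ≠ 0 :=
      Complex.Gamma_ne_zero_of_re_pos (by simpa using hσ)
    have e : ∀ v : ℝ, mellinBarnesKernel p (σ + u * Complex.I) (τ + v * Complex.I) *
        ((x : ℂ) ^ ((σ : ℂ) + u * Complex.I) * (y : ℂ) ^ ((τ : ℂ) + v * Complex.I)) =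
        (Complex.Gamma (p - (σ + u * Complex.I)) / Complex.Gamma (1 + (σ + u * Complex.I)) *
          (x : ℂ) ^ ((σ : ℂ) + u * Complex.I)) *
        (Complex.Gamma (σ + u * Complex.I + (τ + v * Complex.I)) *
          Complex.Gamma (-(τ + v * Complex.I)) * (y : ℂ) ^ ((τ : ℂ) + v * Complex.I)) :=
      fun v => by rw [mellinBarnesKernel]; ring
    simp_rw [e]
    rw [integral_const_mul, integral_Gamma_add_mul_Gamma_neg_mul_cpow hτ (by simpa using hστ) hy,
      add_comm (1 : ℂ), Complex.Gamma_add_one _ hs0, div_eq_mul_one_div x, Complex.ofReal_mul,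
      Complex.mul_cpow_ofReal_nonneg hx.le h1y.le]
    field_simp
  simp only [inner]
  rw [integral_const_mul, integral_Gamma_sub_div_mul_cpow hσ hσp (by positivity)]
  ring

theorem cpow_ofReal_mul {g : ℝ} (hg : 0 < g) (α : ℝ) (s : ℂ) :
    (g : ℂ) ^ ((α : ℂ) * s) = ((g ^ α : ℝ) : ℂ) ^ s := by
  have h1 : (g : ℂ) ≠ 0 := by exact_mod_cast hg.ne'
  have h2 : ((g ^ α : ℝ) : ℂ) ≠ 0 := by exact_mod_cast (Real.rpow_pos_of_pos hg α).ne'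
  rw [Complex.cpow_def_of_ne_zero h1, Complex.cpow_def_of_ne_zero h2, ← Complex.ofReal_log hg.le,
    ← Complex.ofReal_log (Real.rpow_pos_of_pos hg α).le, Real.log_rpow hg]
  congr 1; push_cast; ring

/-- The density of the unnormalized Gamma distribution of shape `a`. -/
def gammaWeight (a g : ℝ) : ℝ := Real.exp (-g) * g ^ (a - 1)

/-- The expectation of `γ(p, x G₁ ^ α / (1 + y G₂ ^ (-β)))` over independent Gamma variables, up to
normalization. -/
def gammaExpectation (p a₁ a₂ α β x y : ℝ) : ℝ :=
  ∫ g : ℝ × ℝ, gammaWeight a₁ g.1 * gammaWeight a₂ g.2 *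
    lowerGamma p (x * g.1 ^ α / (1 + y * g.2 ^ (-β)))
    ∂((volume.restrict (Ioi 0)).prod (volume.restrict (Ioi 0)))

theorem ae_prod_restrict_Ioi : ∀ᵐ g : ℝ × ℝ ∂((volume.restrict (Ioi 0)).prod
    (volume.restrict (Ioi 0))), 0 < g.1 ∧ 0 < g.2 := by
  rw [Measure.prod_restrict]
  filter_upwards [ae_restrict_mem (measurableSet_Ioi.prod measurableSet_Ioi)] with g hg
  exact hg

/-- As Euler integrals, the two extra Gamma factors contribute `g₁ ^ (α s)` and `g₂ ^ (-β t)`, which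
merge with `x ^ s` and `y ^ t`. After the swap, the formula without fading applies pointwise in `g`.
-/
theorem integral_kernel_mul_Gamma_mul_Gamma {p a₁ a₂ α β x y σ τ : ℝ} (hτ : τ < 0)
    (hστ : 0 < σ + τ) (hσp : σ < p) (ha₁ : 0 < a₁) (ha₂ : 0 < a₂) (hα : 0 < α) (hβ : 0 < β)
    (hx : 0 < x) (hy : 0 < y) :
    ∫ w : ℝ × ℝ, mellinBarnesKernel p (σ + w.1 * Complex.I) (τ + w.2 * Complex.I) *
        ((x : ℂ) ^ ((σ : ℂ) + w.1 * Complex.I) * (y : ℂ) ^ ((τ : ℂ) + w.2 * Complex.I)) *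
        (Complex.Gamma (a₁ + α * (σ + w.1 * Complex.I)) *
          Complex.Gamma (a₂ - β * (τ + w.2 * Complex.I))) =
      (2 * Real.pi) ^ 2 * gammaExpectation p a₁ a₂ α β x y := by
  have hσ : 0 < σ := by linarith
  have h1 : 0 < a₁ + α * σ := by positivity
  have h2 : 0 < a₂ - β * τ := by nlinarith
  have key := integral_mul_integral_swap (μ := volume)
    (ν := (volume.restrict (Ioi (0 : ℝ))).prod (volume.restrict (Ioi (0 : ℝ))))
    (K := fun w : ℝ × ℝ => mellinBarnesKernel p (σ + w.1 * Complex.I) (τ + w.2 * Complex.I) *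
        ((x : ℂ) ^ ((σ : ℂ) + w.1 * Complex.I) * (y : ℂ) ^ ((τ : ℂ) + w.2 * Complex.I)))
    (φ := fun w g =>
      (((Real.exp (-g.1) : ℝ) : ℂ) * (g.1 : ℂ) ^ (a₁ + α * (σ + w.1 * Complex.I) - 1)) *
      (((Real.exp (-g.2) : ℝ) : ℂ) * (g.2 : ℂ) ^ (a₂ - β * (τ + w.2 * Complex.I) - 1)))
    (ψ := fun g => (Real.exp (-g.1) * g.1 ^ (a₁ + α * σ - 1)) *
      (Real.exp (-g.2) * g.2 ^ (a₂ - β * τ - 1)))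
    (integrable_mellinBarnesKernel_mul_cpow hτ hστ hσp hx hy)
    ((Real.GammaIntegral_convergent h1).mul_prod (Real.GammaIntegral_convergent h2)) (by
      refine Measurable.aestronglyMeasurable ?_
      simp only [Function.uncurry_def]
      fun_prop) (by
      filter_upwards [ae_prod_restrict_Ioi] with g hg w
      simp only [norm_mul, Complex.norm_real, Real.norm_eq_abs, abs_of_pos (Real.exp_pos _),
        Complex.norm_cpow_eq_rpow_re_of_pos hg.1, Complex.norm_cpow_eq_rpow_re_of_pos hg.2]
      simp)
  have hφ : ∀ w : ℝ × ℝ, ∫ g : ℝ × ℝ,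
      (((Real.exp (-g.1) : ℝ) : ℂ) * (g.1 : ℂ) ^ (a₁ + α * (σ + w.1 * Complex.I) - 1)) *
      (((Real.exp (-g.2) : ℝ) : ℂ) * (g.2 : ℂ) ^ (a₂ - β * (τ + w.2 * Complex.I) - 1))
      ∂((volume.restrict (Ioi (0 : ℝ))).prod (volume.restrict (Ioi (0 : ℝ)))) =
      Complex.Gamma (a₁ + α * (σ + w.1 * Complex.I)) *
          Complex.Gamma (a₂ - β * (τ + w.2 * Complex.I)) := fun w => by
    rw [integral_prod_mul (fun g : ℝ => ((Real.exp (-g) : ℝ) : ℂ) *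
        (g : ℂ) ^ (a₁ + α * (σ + w.1 * Complex.I) - 1))
      (fun g : ℝ => ((Real.exp (-g) : ℝ) : ℂ) *
        (g : ℂ) ^ (a₂ - β * (τ + w.2 * Complex.I) - 1)),
      Complex.Gamma_eq_integral (by simpa using h1), Complex.Gamma_eq_integral (by simpa using h2)]
    rfl
  simp_rw [hφ] at key
  rw [key, gammaExpectation, ← integral_complex_ofReal, ← integral_const_mul]
  refine integral_congr_ae ?_
  filter_upwards [ae_prod_restrict_Ioi] with g ⟨hg1, hg2⟩
  have hg10 : (g.1 : ℂ) ≠ 0 := by exact_mod_cast hg1.ne'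
  have hg20 : (g.2 : ℂ) ≠ 0 := by exact_mod_cast hg2.ne'
  have hr1 := Real.rpow_pos_of_pos hg1 α
  have hr2 := Real.rpow_pos_of_pos hg2 (-β)
  have e : ∀ w : ℝ × ℝ, mellinBarnesKernel p (σ + w.1 * Complex.I) (τ + w.2 * Complex.I) *
        ((x : ℂ) ^ ((σ : ℂ) + w.1 * Complex.I) * (y : ℂ) ^ ((τ : ℂ) + w.2 * Complex.I)) *
      ((((Real.exp (-g.1) : ℝ) : ℂ) * (g.1 : ℂ) ^ (a₁ + α * (σ + w.1 * Complex.I) - 1)) *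
      (((Real.exp (-g.2) : ℝ) : ℂ) * (g.2 : ℂ) ^ (a₂ - β * (τ + w.2 * Complex.I) - 1))) =
      ((gammaWeight a₁ g.1 * gammaWeight a₂ g.2 : ℝ) : ℂ) *
      (mellinBarnesKernel p (σ + w.1 * Complex.I) (τ + w.2 * Complex.I) *
        (((x * g.1 ^ α : ℝ) : ℂ) ^ ((σ : ℂ) + w.1 * Complex.I) *
          ((y * g.2 ^ (-β) : ℝ) : ℂ) ^ ((τ : ℂ) + w.2 * Complex.I))) := fun w => by
    rw [show (a₁ : ℂ) + α * (σ + w.1 * Complex.I) - 1 =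
        ((a₁ - 1 : ℝ) : ℂ) + α * (σ + w.1 * Complex.I) by push_cast; ring,
      show (a₂ : ℂ) - β * (τ + w.2 * Complex.I) - 1 =
        ((a₂ - 1 : ℝ) : ℂ) + ((-β : ℝ) : ℂ) * (τ + w.2 * Complex.I) by push_cast; ring,
      Complex.cpow_add _ _ hg10, Complex.cpow_add _ _ hg20, cpow_ofReal_mul hg1,
      cpow_ofReal_mul hg2, ← Complex.ofReal_cpow hg1.le, ← Complex.ofReal_cpow hg2.le,
      Complex.ofReal_mul x, Complex.ofReal_mul y, Complex.mul_cpow_ofReal_nonneg hx.le hr1.le,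
      Complex.mul_cpow_ofReal_nonneg hy.le hr2.le, gammaWeight, gammaWeight]
    push_cast
    ring
  simp_rw [e]
  rw [integral_const_mul, integral_mellinBarnesKernel_mul_cpow hτ hστ hσp (by positivity)
    (by positivity)]
  push_cast
  ring

/-! ### Evaluation of the bivariate H-function -/

section berFox

variable {p a₁ a₂ α β x y σ τ : ℝ}

/-- The conditions from the fading Gammas are automatic, because the others force `σ > 0` and `τ <
0`. -/
theorem berFox_separates_iff (ha₁ : 0 < a₁) (ha₂ : 0 < a₂) (hα : 0 < α) (hβ : 0 < β) :
    (berFox p (1 - a₁, α) (a₂, β)).Separates σ τ ↔ τ < 0 ∧ 0 < σ + τ ∧ σ < p := by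
  simp only [FoxData.Separates, berFox, List.take_succ_cons, List.take_zero, List.mem_cons,
    List.not_mem_nil, or_false, forall_eq_or_imp, forall_eq, IsEmpty.forall_iff, implies_true]
  constructor
  · rintro ⟨h1, h2, -, ⟨h3, -⟩, -⟩
    refine ⟨?_, ?_, ?_⟩ <;> linarith
  · rintro ⟨h1, h2, h3⟩
    have h4 : 0 < α * σ := mul_pos hα (by linarith)
    have h5 : 0 < β * -τ := mul_pos hβ (by linarith)
    refine ⟨?_, ?_, ?_, ⟨?_, ?_⟩, trivial⟩ <;> linarith

theorem berFox_lineIntegrand (w : ℝ × ℝ) :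
    (berFox p (1 - a₁, α) (a₂, β)).lineIntegrand x y σ τ w =
      mellinBarnesKernel p (σ + w.1 * Complex.I) (τ + w.2 * Complex.I) *
        ((x : ℂ) ^ ((σ : ℂ) + w.1 * Complex.I) * (y : ℂ) ^ ((τ : ℂ) + w.2 * Complex.I)) *
        (Complex.Gamma (a₁ + α * (σ + w.1 * Complex.I)) *
          Complex.Gamma (a₂ - β * (τ + w.2 * Complex.I))) := by
  simp only [FoxData.lineIntegrand, FoxData.integrand, FoxData.coupled, FoxFactor.eval, berFox,
    mellinBarnesKernel, List.take_succ_cons, List.take_zero, List.drop_succ_cons, List.drop_zero,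
    List.map_cons, List.map_nil, List.prod_cons, List.prod_nil, List.take_nil, List.drop_nil]
  push_cast
  simp only [sub_self, zero_add, one_mul, mul_one, div_one, sub_zero, zero_sub, sub_sub_cancel]
  ring

theorem berFox_contourIntegral (ha₁ : 0 < a₁) (ha₂ : 0 < a₂) (hα : 0 < α) (hβ : 0 < β)
    (hx : 0 < x) (hy : 0 < y) (h : (berFox p (1 - a₁, α) (a₂, β)).Separates σ τ) :
    (berFox p (1 - a₁, α) (a₂, β)).contourIntegral x y σ τ =
      gammaExpectation p a₁ a₂ α β x y := by
  rw [berFox_separates_iff ha₁ ha₂ hα hβ] at h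
  obtain ⟨hτ, hστ, hσp⟩ := h
  have hpi : (Real.pi : ℂ) ≠ 0 := by exact_mod_cast Real.pi_ne_zero
  have hI := Complex.I_ne_zero
  simp_rw [FoxData.contourIntegral, berFox_lineIntegrand]
  rw [integral_kernel_mul_Gamma_mul_Gamma hτ hστ hσp ha₁ ha₂ hα hβ hx hy]
  field_simp

theorem berFox_exists_separates (hp : 0 < p) (ha₁ : 0 < a₁) (ha₂ : 0 < a₂) (hα : 0 < α)
    (hβ : 0 < β) : ∃ σ τ : ℝ, (berFox p (1 - a₁, α) (a₂, β)).Separates σ τ := by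
  -- A point inside the open triangle with vertices `(0, 0)`, `(p, 0)`, `(p, -p)`.
  refine ⟨p / 2, -(p / 4), ?_⟩
  rw [berFox_separates_iff ha₁ ha₂ hα hβ]
  refine ⟨?_, ?_, ?_⟩ <;> linarith

theorem berFox_foxH (hp : 0 < p) (ha₁ : 0 < a₁) (ha₂ : 0 < a₂) (hα : 0 < α) (hβ : 0 < β)
    (hx : 0 < x) (hy : 0 < y) :
    (berFox p (1 - a₁, α) (a₂, β)).foxH x y = gammaExpectation p a₁ a₂ α β x y := by
  have h : ∃ c : ℝ × ℝ, (berFox p (1 - a₁, α) (a₂, β)).Separates c.1 c.2 := by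
    obtain ⟨σ, τ, h⟩ := berFox_exists_separates hp ha₁ ha₂ hα hβ
    exact ⟨(σ, τ), h⟩
  rw [FoxData.foxH, dif_pos h]
  exact berFox_contourIntegral ha₁ ha₂ hα hβ hx hy h.choose_spec

theorem berFox_wellDefinedAt (hp : 0 < p) (ha₁ : 0 < a₁) (ha₂ : 0 < a₂) (hα : 0 < α) (hβ : 0 < β)
    (hx : 0 < x) (hy : 0 < y) : (berFox p (1 - a₁, α) (a₂, β)).WellDefinedAt x y := by
  refine ⟨berFox_exists_separates hp ha₁ ha₂ hα hβ, fun σ τ h => ⟨?_, ?_⟩⟩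
  · rw [berFox_separates_iff ha₁ ha₂ hα hβ] at h
    obtain ⟨hτ, hστ, hσp⟩ := h
    have h1 : 0 < a₁ + α * σ := by have := mul_pos hα (show 0 < σ by linarith); linarith
    have h2 : 0 < a₂ - β * τ := by nlinarith
    -- The kernel is already integrable, and the fading Gammas are bounded on their lines by their
    -- values at the real parts.
    refine (((integrable_mellinBarnesKernel_mul_cpow hτ hστ hσp hx hy).mul_bdd
      (c := Real.Gamma (a₁ + α * σ) * Real.Gamma (a₂ - β * τ))
      ((continuous_Gamma_comp (f := fun w : ℝ × ℝ => (a₁ : ℂ) + α * (σ + w.1 * Complex.I))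
          (by fun_prop) fun w => by simpa using h1).mul
        (continuous_Gamma_comp (f := fun w : ℝ × ℝ => (a₂ : ℂ) - β * (τ + w.2 * Complex.I))
          (by fun_prop) fun w => by simpa using h2)).aestronglyMeasurable
      (Filter.Eventually.of_forall fun w => ?_))).congr
      (Filter.Eventually.of_forall fun w => (berFox_lineIntegrand w).symm)
    rw [Pi.mul_apply, norm_mul]
    refine mul_le_mul ?_ ?_ (norm_nonneg _) (Real.Gamma_pos_of_pos h1).le
    · refine (norm_Gamma_le (by simpa using h1)).trans_eq ?_
      simp
    · refine (norm_Gamma_le (by simpa using h2)).trans_eq ?_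
      simp
  · rw [berFox_foxH hp ha₁ ha₂ hα hβ hx hy, berFox_contourIntegral ha₁ ha₂ hα hβ hx hy h]

end berFox


/-! ### Generalized Gamma laws and their mixtures -/

/-- The generalized Gamma density. -/
def genGammaPDF (a b c x : ℝ) : ℝ :=
  c * x ^ (a * c - 1) / (b ^ (a * c) * Real.Gamma a) * Real.exp (-(x / b) ^ c)

/-- The generalized Gamma distribution, concentrated on `(0, ∞)`. -/
def genGammaMeasure (a b c : ℝ) : Measure ℝ :=
  (volume.restrict (Ioi 0)).withDensity fun x => ENNReal.ofReal (genGammaPDF a b c x)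

@[fun_prop]
theorem measurable_genGammaPDF (a b c : ℝ) : Measurable (genGammaPDF a b c) := by
  unfold genGammaPDF; fun_prop

theorem genGammaPDF_nonneg {a b c x : ℝ} (ha : 0 < a) (hb : 0 < b) (hc : 0 < c) (hx : 0 < x) :
    0 ≤ genGammaPDF a b c x := by
  have := Real.Gamma_pos_of_pos ha
  unfold genGammaPDF; positivity

theorem eggPDF_eq (ω lam a b c : ℝ) {x : ℝ} :
    eggPDF ω lam a b c x = ω * genGammaPDF 1 lam 1 x + (1 - ω) * genGammaPDF a b c x := by
  simp only [eggPDF, genGammaPDF, mul_one, sub_self, Real.rpow_zero, Real.rpow_one, Real.Gamma_one]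
  ring

theorem eggMeasure_eq {ω lam a b c : ℝ} (hω : 0 < ω ∧ ω < 1) (hlam : 0 < lam) (ha : 0 < a)
    (hb : 0 < b) (hc : 0 < c) :
    eggMeasure ω lam a b c = ENNReal.ofReal ω • genGammaMeasure 1 lam 1 +
      ENNReal.ofReal (1 - ω) • genGammaMeasure a b c := by
  rw [eggMeasure, genGammaMeasure, genGammaMeasure, ← withDensity_smul _ (by fun_prop),
    ← withDensity_smul _ (by fun_prop), ← withDensity_add_left (by fun_prop)]
  refine withDensity_congr_ae ?_
  filter_upwards [ae_restrict_mem measurableSet_Ioi] with x hx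
  have h1 := genGammaPDF_nonneg one_pos hlam one_pos hx
  have h2 := genGammaPDF_nonneg ha hb hc hx
  have h3 : 0 ≤ 1 - ω := by linarith [hω.2]
  rw [eggPDF_eq, ENNReal.ofReal_add (mul_nonneg hω.1.le h1) (mul_nonneg h3 h2),
    ENNReal.ofReal_mul hω.1.le, ENNReal.ofReal_mul h3]
  rfl

/-- Under the generalized Gamma distribution, the variable is `b G ^ (1 / c)` with `G` Gamma
distributed. -/
theorem setIntegral_genGammaPDF_mul {a b c : ℝ} (hb : 0 < b) (hc : 0 < c)
    (F : ℝ → ℝ) :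
    ∫ x in Ioi 0, genGammaPDF a b c x * F x =
      (Real.Gamma a)⁻¹ * ∫ g in Ioi 0, gammaWeight a g * F (b * g ^ (1 / c)) := by
  -- Substitute `g = y ^ c` on the right and `x = b y` on the left; neither change of variables
  -- needs integrability of `F`.
  rw [← integral_comp_rpow_Ioi_of_pos (g := fun g => gammaWeight a g * F (b * g ^ (1 / c))) hc]
  have h := integral_comp_mul_left_Ioi (fun x => genGammaPDF a b c x * F x) 0 hb
  rw [mul_zero, smul_eq_mul, inv_mul_eq_div, eq_div_iff hb.ne'] at h
  rw [← h, mul_comm, ← integral_const_mul, ← integral_const_mul]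
  refine setIntegral_congr_fun measurableSet_Ioi fun y (hy : 0 < y) => ?_
  have e1 : (y ^ c) ^ (1 / c) = y := by
    rw [← Real.rpow_mul hy.le, mul_one_div_cancel hc.ne', Real.rpow_one]
  have e2 : (y ^ c) ^ (a - 1) = y ^ (a * c - 1) / y ^ (c - 1) := by
    rw [← Real.rpow_mul hy.le, ← Real.rpow_sub hy]; congr 1; ring
  have e3 : b * y / b = y := by field_simp
  have e4 : (b * y) ^ (a * c - 1) = b ^ (a * c) / b * y ^ (a * c - 1) := by
    rw [Real.mul_rpow hb.le hy.le, Real.rpow_sub_one hb.ne']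
  have h5 := Real.rpow_pos_of_pos hy (c - 1)
  have h6 := Real.rpow_pos_of_pos hb (a * c)
  simp only [genGammaPDF, gammaWeight, smul_eq_mul, e1, e2, e3, e4]
  field_simp

theorem integral_genGammaMeasure {a b c : ℝ} (ha : 0 < a) (hb : 0 < b) (hc : 0 < c)
    (F : ℝ → ℝ) :
    ∫ x, F x ∂genGammaMeasure a b c =
      (Real.Gamma a)⁻¹ * ∫ g in Ioi 0, gammaWeight a g * F (b * g ^ (1 / c)) := by
  rw [genGammaMeasure, integral_withDensity_eq_integral_toReal_smul (by fun_prop) (by simp),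
    ← setIntegral_genGammaPDF_mul hb hc]
  refine setIntegral_congr_fun measurableSet_Ioi fun x hx => ?_
  simp only [smul_eq_mul, ENNReal.toReal_ofReal (genGammaPDF_nonneg ha hb hc hx)]

theorem isFiniteMeasure_genGammaMeasure {a b c : ℝ} (ha : 0 < a) (hb : 0 < b) (hc : 0 < c) :
    IsFiniteMeasure (genGammaMeasure a b c) := by
  -- A non-integrable function has Bochner integral `0`, so it is enough that the integral of the
  -- density evaluates to `1`.
  refine isFiniteMeasure_withDensity_ofReal (Integrable.of_integral_ne_zero ?_).2
  have h := setIntegral_genGammaPDF_mul (a := a) hb hc fun _ => 1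
  simp only [mul_one, gammaWeight, ← Real.Gamma_eq_integral ha] at h
  rw [h, inv_mul_cancel₀ (Real.Gamma_pos_of_pos ha).ne']
  exact one_ne_zero

theorem eggMeasure_absolutelyContinuous (ω lam a b c : ℝ) :
    eggMeasure ω lam a b c ≪ volume.restrict (Ioi 0) :=
  withDensity_absolutelyContinuous _ _

theorem integral_eggMeasure {ω lam a b c M : ℝ} (hω : 0 < ω ∧ ω < 1) (hlam : 0 < lam) (ha : 0 < a)
    (hb : 0 < b) (hc : 0 < c) {F : ℝ → ℝ} (hF : StronglyMeasurable F) (hM : ∀ x, ‖F x‖ ≤ M) :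
    ∫ x, F x ∂eggMeasure ω lam a b c =
      ω * ∫ x, F x ∂genGammaMeasure 1 lam 1 + (1 - ω) * ∫ x, F x ∂genGammaMeasure a b c := by
  have := isFiniteMeasure_genGammaMeasure one_pos hlam one_pos
  have := isFiniteMeasure_genGammaMeasure ha hb hc
  have h3 : 0 ≤ 1 - ω := by linarith [hω.2]
  rw [eggMeasure_eq hω hlam ha hb hc, integral_add_measure, integral_smul_measure,
    integral_smul_measure, ENNReal.toReal_ofReal hω.1.le, ENNReal.toReal_ofReal h3]
  · rfl
  · exact (Integrable.of_bound hF.aestronglyMeasurable M (Filter.Eventually.of_forall hM)).smul_measure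
      ENNReal.ofReal_ne_top
  · exact (Integrable.of_bound hF.aestronglyMeasurable M (Filter.Eventually.of_forall hM)).smul_measure
      ENNReal.ofReal_ne_top

theorem integral_prod_genGammaMeasure {a₁ b₁ c₁ a₂ b₂ c₂ M : ℝ} (ha₁ : 0 < a₁) (hb₁ : 0 < b₁)
    (hc₁ : 0 < c₁) (ha₂ : 0 < a₂) (hb₂ : 0 < b₂) (hc₂ : 0 < c₂) {F : ℝ → ℝ → ℝ}
    (hF : Measurable (Function.uncurry F)) (hM : ∀ x y, ‖F x y‖ ≤ M) :
    ∫ x, ∫ y, F x y ∂genGammaMeasure a₂ b₂ c₂ ∂genGammaMeasure a₁ b₁ c₁ =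
      (Real.Gamma a₁)⁻¹ * (Real.Gamma a₂)⁻¹ * ∫ g : ℝ × ℝ, gammaWeight a₁ g.1 * gammaWeight a₂ g.2 *
        F (b₁ * g.1 ^ (1 / c₁)) (b₂ * g.2 ^ (1 / c₂))
        ∂((volume.restrict (Ioi 0)).prod (volume.restrict (Ioi 0))) := by
  simp_rw [integral_genGammaMeasure ha₂ hb₂ hc₂]
  rw [integral_genGammaMeasure ha₁ hb₁ hc₁, integral_prod]
  · rw [mul_assoc]
    congr 1
    rw [← integral_const_mul]
    refine setIntegral_congr_fun measurableSet_Ioi fun g _ => ?_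
    simp only [mul_assoc, integral_const_mul]
    ring
  · refine ((Real.GammaIntegral_convergent ha₁).mul_prod
      (Real.GammaIntegral_convergent ha₂)).mul_bdd (c := M) ?_ ?_
    · exact (hF.comp (f := fun g : ℝ × ℝ => (b₁ * g.1 ^ (1 / c₁), b₂ * g.2 ^ (1 / c₂)))
        (by fun_prop)).aestronglyMeasurable
    · exact Filter.Eventually.of_forall fun g => hM _ _

/-- Bilinearity in the two mixtures; boundedness of `F` and finiteness of the component laws supply
every integrability condition. -/
theorem integral_eggMeasure_prod {ω₁ ω₂ lam₁ lam₂ a₁ a₂ b₁ b₂ c₁ c₂ M : ℝ}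
    (hω₁ : 0 < ω₁ ∧ ω₁ < 1) (hω₂ : 0 < ω₂ ∧ ω₂ < 1) (hlam₁ : 0 < lam₁) (hlam₂ : 0 < lam₂)
    (ha₁ : 0 < a₁) (ha₂ : 0 < a₂) (hb₁ : 0 < b₁) (hb₂ : 0 < b₂) (hc₁ : 0 < c₁) (hc₂ : 0 < c₂)
    {F : ℝ → ℝ → ℝ} (hF : Measurable (Function.uncurry F)) (hM : ∀ x y, ‖F x y‖ ≤ M) :
    ∫ x, ∫ y, F x y ∂eggMeasure ω₂ lam₂ a₂ b₂ c₂ ∂eggMeasure ω₁ lam₁ a₁ b₁ c₁ =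
      ω₁ * (ω₂ * ∫ x, ∫ y, F x y ∂genGammaMeasure 1 lam₂ 1 ∂genGammaMeasure 1 lam₁ 1 +
        (1 - ω₂) * ∫ x, ∫ y, F x y ∂genGammaMeasure a₂ b₂ c₂ ∂genGammaMeasure 1 lam₁ 1) +
      (1 - ω₁) * (ω₂ * ∫ x, ∫ y, F x y ∂genGammaMeasure 1 lam₂ 1 ∂genGammaMeasure a₁ b₁ c₁ +
        (1 - ω₂) * ∫ x, ∫ y, F x y ∂genGammaMeasure a₂ b₂ c₂ ∂genGammaMeasure a₁ b₁ c₁) := by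
  have i1 := isFiniteMeasure_genGammaMeasure one_pos hlam₂ one_pos
  have i2 := isFiniteMeasure_genGammaMeasure ha₂ hb₂ hc₂
  have hin : ∀ x, ∫ y, F x y ∂eggMeasure ω₂ lam₂ a₂ b₂ c₂ =
      ω₂ * ∫ y, F x y ∂genGammaMeasure 1 lam₂ 1 +
        (1 - ω₂) * ∫ y, F x y ∂genGammaMeasure a₂ b₂ c₂ := fun x =>
    integral_eggMeasure hω₂ hlam₂ ha₂ hb₂ hc₂
      (hF.comp measurable_prodMk_left).stronglyMeasurable (hM x)
  have hmeas : ∀ (ν : Measure ℝ) [SFinite ν], StronglyMeasurable fun x => ∫ y, F x y ∂ν :=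
    fun ν _ => hF.stronglyMeasurable.integral_prod_right
  have hbd : ∀ (ν : Measure ℝ) [IsFiniteMeasure ν] (x : ℝ), ‖∫ y, F x y ∂ν‖ ≤ M * ν.real univ :=
    fun ν _ x => norm_integral_le_of_norm_le_const (Filter.Eventually.of_forall (hM x))
  have hout : ∀ (ν : Measure ℝ) [IsFiniteMeasure ν], ∀ (a b c : ℝ), 0 < a → 0 < b → 0 < c →
      Integrable (fun x => ∫ y, F x y ∂ν) (genGammaMeasure a b c) := fun ν _ a b c ha hb hc => by
    have := isFiniteMeasure_genGammaMeasure ha hb hc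
    exact Integrable.of_bound (hmeas ν).aestronglyMeasurable _
      (Filter.Eventually.of_forall (hbd ν))
  simp_rw [hin]
  rw [integral_eggMeasure (M := |ω₂| * (M * (genGammaMeasure 1 lam₂ 1).real univ) +
      |1 - ω₂| * (M * (genGammaMeasure a₂ b₂ c₂).real univ)) hω₁ hlam₁ ha₁ hb₁ hc₁,
    integral_add ((hout _ _ _ _ one_pos hlam₁ one_pos).const_mul _)
      ((hout _ _ _ _ one_pos hlam₁ one_pos).const_mul _),
    integral_add ((hout _ _ _ _ ha₁ hb₁ hc₁).const_mul _)
      ((hout _ _ _ _ ha₁ hb₁ hc₁).const_mul _)]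
  · simp_rw [integral_const_mul]
  · exact ((hmeas _).const_mul _).add ((hmeas _).const_mul _)
  · intro x
    refine (norm_add_le _ _).trans ?_
    rw [norm_mul, norm_mul, Real.norm_eq_abs, Real.norm_eq_abs (1 - ω₂)]
    gcongr
    · exact hbd _ x
    · exact hbd _ x

/-! ### Incomplete Gamma functions -/

section incompleteGamma

variable {p : ℝ}

theorem integrableOn_gamma_integrand (hp : 0 < p) :
    IntegrableOn (fun t : ℝ => t ^ (p - 1) * Real.exp (-t)) (Ioi 0) := by
  simpa only [mul_comm] using Real.GammaIntegral_convergent hp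

/-- Serves to make `lowerGamma p` Borel measurable. -/
theorem lowerGamma_mono (hp : 0 < p) : Monotone (lowerGamma p) := by
  intro x y hxy
  refine setIntegral_mono_set ((integrableOn_gamma_integrand hp).mono_set Ioc_subset_Ioi_self) ?_
    (Ioc_subset_Ioc_right hxy).eventuallyLE
  filter_upwards [ae_restrict_mem measurableSet_Ioc] with t ht
  have := ht.1
  simp only [Pi.zero_apply]; positivity

theorem lowerGamma_nonneg (p x : ℝ) : 0 ≤ lowerGamma p x :=
  setIntegral_nonneg measurableSet_Ioc fun t ht => by have := ht.1; positivity

theorem norm_lowerGamma_le (hp : 0 < p) (x : ℝ) : ‖lowerGamma p x‖ ≤ Real.Gamma p := by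
  rw [Real.norm_eq_abs, abs_of_nonneg (lowerGamma_nonneg p x), Real.Gamma_eq_integral hp]
  simp only [mul_comm (Real.exp _)]
  refine setIntegral_mono_set (integrableOn_gamma_integrand hp) ?_ Ioc_subset_Ioi_self.eventuallyLE
  filter_upwards [ae_restrict_mem measurableSet_Ioi] with t ht
  have : 0 < t := ht
  simp only [Pi.zero_apply]; positivity

theorem upperGamma_eq (hp : 0 < p) {x : ℝ} (hx : 0 ≤ x) :
    upperGamma p x = Real.Gamma p - lowerGamma p x := by
  have hI := integrableOn_gamma_integrand hp
  rw [upperGamma, lowerGamma, Real.Gamma_eq_integral hp]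
  simp only [mul_comm (Real.exp _)]
  rw [← Ioc_union_Ioi_eq_Ioi hx, setIntegral_union (Ioc_disjoint_Ioi le_rfl) measurableSet_Ioi
    (hI.mono_set Ioc_subset_Ioi_self) (hI.mono_set (Ioi_subset_Ioi hx)), add_sub_cancel_left]

end incompleteGamma

/-- The set lies in the image of `N ∩ (0, ∞)` under the inverse `z ↦ (z / k) ^ (1 / r)`, which is
differentiable there and so preserves null sets. -/
theorem volume_preimage_const_mul_pow {k : ℝ} (hk : 0 < k) {r : ℕ} (hr : r ≠ 0) {N : Set ℝ}
    (hN : volume N = 0) : volume {x : ℝ | 0 < x ∧ k * x ^ r ∈ N} = 0 := by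
  have h0 : volume (N ∩ Ioi 0) = 0 := measure_mono_null inter_subset_left hN
  have hd : DifferentiableOn ℝ (fun z : ℝ => (z / k) ^ ((r : ℝ)⁻¹)) (N ∩ Ioi 0) := by
    intro z hz
    have hz0 : z / k ≠ 0 := (div_pos hz.2 hk).ne'
    exact ((differentiableAt_id.div_const k).rpow_const (Or.inl hz0)).differentiableWithinAt
  refine measure_mono_null ?_
    (addHaar_image_eq_zero_of_differentiableOn_of_addHaar_eq_zero volume hd h0)
  rintro x ⟨hx, hxN⟩
  refine ⟨k * x ^ r, ⟨hxN, mem_Ioi.2 (by positivity)⟩, ?_⟩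
  simp only
  rw [mul_div_cancel_left₀ _ hk.ne', Real.pow_rpow_inv_natCast hx.le hr]


/-! ### The end-to-end SNR: density and expectations -/

section dualHop

variable {η N₁ N₂ C : ℝ} {r₁ r₂ : ℕ}

theorem hopSNR_pos {η N x : ℝ} (hη : 0 < η) (hN : 0 < N) (r : ℕ) (hx : 0 < x) :
    0 < hopSNR η N r x := by
  unfold hopSNR; positivity

theorem measurable_endToEndSNR_hopSNR :
    Measurable fun z : ℝ × ℝ => endToEndSNR C (hopSNR η N₁ r₁ z.1) (hopSNR η N₂ r₂ z.2) := by
  unfold endToEndSNR hopSNR; fun_prop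

variable {Ω : Type*} [MeasurableSpace Ω] {P : Measure Ω} {I₁ I₂ : Ω → ℝ}

theorem hasPDF_endToEndSNR [IsProbabilityMeasure P] (hη : 0 < η) (hN₁ : 0 < N₁) (hN₂ : 0 < N₂)
    (hC : 0 < C) (hr₁ : r₁ ≠ 0) (hI₁ : AEMeasurable I₁ P) (hI₂ : AEMeasurable I₂ P)
    (hac₁ : P.map I₁ ≪ volume.restrict (Ioi 0)) (hac₂ : P.map I₂ ≪ volume.restrict (Ioi 0))
    (hind : IndepFun I₁ I₂ P) :
    HasPDF (fun w => endToEndSNR C (hopSNR η N₁ r₁ (I₁ w)) (hopSNR η N₂ r₂ (I₂ w))) P volume := by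
  have hm : Measurable fun z : ℝ × ℝ =>
      endToEndSNR C (hopSNR η N₁ r₁ z.2) (hopSNR η N₂ r₂ z.1) := by
    unfold endToEndSNR hopSNR; fun_prop
  -- `I₂` comes first so that the null-set criterion for product measures slices at a fixed value of
  -- `I₂`; there the SNR is a positive constant times `I₁ ^ r₁`.
  have hpair : AEMeasurable (fun w => (I₂ w, I₁ w)) P := hI₂.prodMk hI₁
  have := Measure.isProbabilityMeasure_map hI₁
  refine (Real.hasPDF_iff_of_aemeasurable (hm.comp_aemeasurable hpair)).2 ?_
  refine Measure.AbsolutelyContinuous.mk fun N hNm hN => ?_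
  have hmap := AEMeasurable.map_map_of_aemeasurable hm.aemeasurable hpair
  rw [(indepFun_iff_map_prod_eq_prod_map_map hI₂ hI₁).1 hind.symm] at hmap
  change P.map ((fun z : ℝ × ℝ => endToEndSNR C (hopSNR η N₁ r₁ z.2) (hopSNR η N₂ r₂ z.1)) ∘
    fun w => (I₂ w, I₁ w)) N = 0
  rw [← hmap, Measure.map_apply hm hNm, Measure.measure_prod_null (hm hNm)]
  filter_upwards [hac₂.ae_le (ae_restrict_mem measurableSet_Ioi)] with y hy
  refine hac₁ ?_
  have h2 := hopSNR_pos hη hN₂ r₂ hy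
  set g := hopSNR η N₂ r₂ y
  have hk : 0 < η ^ r₁ / N₁ * (g / (g + C)) := by positivity
  rw [Measure.restrict_apply (measurable_prodMk_left (hm hNm))]
  refine measure_mono_null ?_ (volume_preimage_const_mul_pow hk hr₁ hN)
  rintro x ⟨hxN, hx⟩
  refine ⟨hx, ?_⟩
  have e : η ^ r₁ / N₁ * (g / (g + C)) * x ^ r₁ = endToEndSNR C (hopSNR η N₁ r₁ x) g := by
    unfold endToEndSNR hopSNR
    rw [mul_pow]; ring
  rw [e]
  exact hxN

/-- The average of `Γ(p, q ·)` against the density of a positive random variable. -/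
theorem integral_upperGamma_mul_pdf [IsProbabilityMeasure P] {γ : Ω → ℝ} [HasPDF γ P volume]
    (hγ : ∀ᵐ w ∂P, 0 < γ w) {p q : ℝ} (hp : 0 < p) (hq : 0 < q) :
    IntegrableOn (fun x => upperGamma p (q * x) * (pdf γ P volume x).toReal) (Ioi 0) ∧
    ∫ x in Ioi 0, upperGamma p (q * x) * (pdf γ P volume x).toReal =
      Real.Gamma p - ∫ w, lowerGamma p (q * γ w) ∂P := by
  have hγm : AEMeasurable γ P := HasPDF.aemeasurable γ P volume
  have hlm : Measurable fun x => lowerGamma p (q * x) :=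
    (lowerGamma_mono hp).measurable.comp (measurable_const_mul q)
  -- The indicator restricts to positive arguments, where `upperGamma_eq` applies; it is almost
  -- surely invisible along `γ`.
  set f : ℝ → ℝ := (Ioi (0 : ℝ)).indicator fun x => Real.Gamma p - lowerGamma p (q * x) with hf
  have hfm : AEStronglyMeasurable f volume :=
    ((measurable_const.sub hlm).indicator measurableSet_Ioi).aestronglyMeasurable
  have hfun : (fun x => (pdf γ P volume x).toReal • f x) =
      (Ioi (0 : ℝ)).indicator fun x => upperGamma p (q * x) * (pdf γ P volume x).toReal := by
    ext x
    by_cases hx : x ∈ Ioi (0 : ℝ)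
    · rw [hf, indicator_of_mem hx, indicator_of_mem hx, upperGamma_eq hp (mul_pos hq hx).le,
        smul_eq_mul, mul_comm]
    · rw [hf, indicator_of_notMem hx, indicator_of_notMem hx, smul_zero]
  have hfγ : (fun w => Real.Gamma p - lowerGamma p (q * γ w)) =ᵐ[P] fun w => f (γ w) := by
    filter_upwards [hγ] with w hw
    rw [hf, indicator_of_mem (mem_Ioi.2 hw)]
  have hL : Integrable (fun w => lowerGamma p (q * γ w)) P :=
    Integrable.of_bound (hlm.comp_aemeasurable hγm).aestronglyMeasurable _
      (Filter.Eventually.of_forall fun w => norm_lowerGamma_le hp _)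
  constructor
  · rw [← integrable_indicator_iff measurableSet_Ioi, ← hfun, pdf.integrable_pdf_smul_iff hfm]
    exact ((integrable_const _).sub hL).congr hfγ
  · rw [← integral_indicator measurableSet_Ioi, ← hfun, pdf.integral_pdf_smul hfm,
      ← integral_congr_ae hfγ, integral_sub (integrable_const _) hL]
    simp

/-- With `Iᵢ = bᵢ Gᵢ ^ (1 / cᵢ)`, each hop SNR is `bᵢ ^ rᵢ μᵢ Gᵢ ^ (rᵢ / cᵢ)`; dividing numerator
and denominator of the end-to-end SNR by `γ₂` gives the two H-function arguments. -/
theorem integral_lowerGamma_genGammaMeasure {p q a₁ b₁ c₁ a₂ b₂ c₂ : ℝ} (hp : 0 < p)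
    (ha₁ : 0 < a₁) (hb₁ : 0 < b₁) (hc₁ : 0 < c₁) (ha₂ : 0 < a₂)
    (hb₂ : 0 < b₂) (hc₂ : 0 < c₂) (hη : 0 < η) (hN₂ : 0 < N₂) (hC : 0 < C) :
    ∫ x, ∫ y, lowerGamma p (q * endToEndSNR C (hopSNR η N₁ r₁ x) (hopSNR η N₂ r₂ y))
      ∂genGammaMeasure a₂ b₂ c₂ ∂genGammaMeasure a₁ b₁ c₁ =
      gammaExpectation p a₁ a₂ (r₁ / c₁) (r₂ / c₂) (q * b₁ ^ r₁ * electricalSNR η N₁ r₁)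
        (C / (b₂ ^ r₂ * electricalSNR η N₂ r₂)) / (Real.Gamma a₁ * Real.Gamma a₂) := by
  have hm : Measurable (Function.uncurry fun x y : ℝ =>
      lowerGamma p (q * endToEndSNR C (hopSNR η N₁ r₁ x) (hopSNR η N₂ r₂ y))) :=
    (lowerGamma_mono hp).measurable.comp (measurable_endToEndSNR_hopSNR.const_mul q)
  rw [integral_prod_genGammaMeasure (M := Real.Gamma p) ha₁ hb₁ hc₁ ha₂ hb₂ hc₂ hm
    (fun x y => norm_lowerGamma_le hp _), ← mul_inv, inv_mul_eq_div, gammaExpectation]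
  congr 1
  refine integral_congr_ae ?_
  filter_upwards [ae_prod_restrict_Ioi] with g ⟨hg1, hg2⟩
  congr 2
  have e1 : (g.1 ^ (1 / c₁)) ^ r₁ = g.1 ^ ((r₁ : ℝ) / c₁) := by
    rw [← Real.rpow_natCast, ← Real.rpow_mul hg1.le]; congr 1; ring
  have e2 : (g.2 ^ (1 / c₂)) ^ r₂ = g.2 ^ ((r₂ : ℝ) / c₂) := by
    rw [← Real.rpow_natCast, ← Real.rpow_mul hg2.le]; congr 1; ring
  have h2 := Real.rpow_pos_of_pos hg2 ((r₂ : ℝ) / c₂)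
  simp only [endToEndSNR, hopSNR, electricalSNR, mul_pow, e1, e2, Real.rpow_neg hg2.le]
  field_simp

theorem integral_lowerGamma_endToEndSNR [IsProbabilityMeasure P]
    {ω₁ ω₂ lam₁ lam₂ a₁ a₂ b₁ b₂ c₁ c₂ p q : ℝ}
    (hω₁ : 0 < ω₁ ∧ ω₁ < 1) (hω₂ : 0 < ω₂ ∧ ω₂ < 1) (hlam₁ : 0 < lam₁) (hlam₂ : 0 < lam₂)
    (ha₁ : 0 < a₁) (ha₂ : 0 < a₂) (hb₁ : 0 < b₁) (hb₂ : 0 < b₂) (hc₁ : 0 < c₁) (hc₂ : 0 < c₂)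
    (hI₁ : HasLaw I₁ (eggMeasure ω₁ lam₁ a₁ b₁ c₁) P)
    (hI₂ : HasLaw I₂ (eggMeasure ω₂ lam₂ a₂ b₂ c₂) P) (hind : IndepFun I₁ I₂ P)
    (hη : 0 < η) (hN₂ : 0 < N₂) (hC : 0 < C) (hp : 0 < p) :
    ∫ w, lowerGamma p (q * endToEndSNR C (hopSNR η N₁ r₁ (I₁ w)) (hopSNR η N₂ r₂ (I₂ w))) ∂P =
      ω₁ * ω₂ * gammaExpectation p 1 1 r₁ r₂ (q * lam₁ ^ r₁ * electricalSNR η N₁ r₁)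
        (C / (lam₂ ^ r₂ * electricalSNR η N₂ r₂)) +
      ω₁ * (1 - ω₂) / Real.Gamma a₂ * gammaExpectation p 1 a₂ r₁ (r₂ / c₂)
        (q * lam₁ ^ r₁ * electricalSNR η N₁ r₁) (C / (b₂ ^ r₂ * electricalSNR η N₂ r₂)) +
      ω₂ * (1 - ω₁) / Real.Gamma a₁ * gammaExpectation p a₁ 1 (r₁ / c₁) r₂
        (q * b₁ ^ r₁ * electricalSNR η N₁ r₁) (C / (lam₂ ^ r₂ * electricalSNR η N₂ r₂)) +
      (1 - ω₁) * (1 - ω₂) / (Real.Gamma a₁ * Real.Gamma a₂) *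
        gammaExpectation p a₁ a₂ (r₁ / c₁) (r₂ / c₂)
        (q * b₁ ^ r₁ * electricalSNR η N₁ r₁) (C / (b₂ ^ r₂ * electricalSNR η N₂ r₂)) := by
  have hm : Measurable (Function.uncurry fun x y : ℝ =>
      lowerGamma p (q * endToEndSNR C (hopSNR η N₁ r₁ x) (hopSNR η N₂ r₂ y))) :=
    (lowerGamma_mono hp).measurable.comp (measurable_endToEndSNR_hopSNR.const_mul q)
  have hb : ∀ x y : ℝ,
      ‖lowerGamma p (q * endToEndSNR C (hopSNR η N₁ r₁ x) (hopSNR η N₂ r₂ y))‖ ≤ Real.Gamma p :=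
    fun x y => norm_lowerGamma_le hp _
  have := Measure.isProbabilityMeasure_map hI₁.aemeasurable
  have := Measure.isProbabilityMeasure_map hI₂.aemeasurable
  have hmap := (indepFun_iff_map_prod_eq_prod_map_map hI₁.aemeasurable hI₂.aemeasurable).1 hind
  have h1 := integral_map (hI₁.aemeasurable.prodMk hI₂.aemeasurable)
    (f := Function.uncurry fun x y : ℝ =>
      lowerGamma p (q * endToEndSNR C (hopSNR η N₁ r₁ x) (hopSNR η N₂ r₂ y)))
    hm.aestronglyMeasurable
  rw [hmap, integral_prod _ (Integrable.of_bound hm.aestronglyMeasurable _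
    (Filter.Eventually.of_forall fun z => hb z.1 z.2))] at h1
  simp only [Function.uncurry_apply_pair] at h1
  rw [← h1, hI₁.map_eq, hI₂.map_eq, integral_eggMeasure_prod hω₁ hω₂ hlam₁ hlam₂ ha₁ ha₂ hb₁ hb₂ hc₁
    hc₂ hm hb]
  rw [integral_lowerGamma_genGammaMeasure hp one_pos hlam₁ one_pos one_pos hlam₂ one_pos hη hN₂ hC,
    integral_lowerGamma_genGammaMeasure hp one_pos hlam₁ one_pos ha₂ hb₂ hc₂ hη hN₂ hC,
    integral_lowerGamma_genGammaMeasure hp ha₁ hb₁ hc₁ one_pos hlam₂ one_pos hη hN₂ hC,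
    integral_lowerGamma_genGammaMeasure hp ha₁ hb₁ hc₁ ha₂ hb₂ hc₂ hη hN₂ hC]
  simp only [div_one, Real.Gamma_one, one_mul, mul_one]
  ring

end dualHop

end UWOC

end

/-! ### The average bit-error rate -/

open UWOC in
theorem theorem4 {Ω : Type*} [MeasurableSpace Ω] (P : Measure Ω) [IsProbabilityMeasure P]
    (ω₁ ω₂ lam₁ lam₂ a₁ a₂ b₁ b₂ c₁ c₂ : ℝ)
    (hω₁ : 0 < ω₁ ∧ ω₁ < 1) (hω₂ : 0 < ω₂ ∧ ω₂ < 1)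
    (hlam₁ : 0 < lam₁) (hlam₂ : 0 < lam₂) (ha₁ : 0 < a₁) (ha₂ : 0 < a₂)
    (hb₁ : 0 < b₁) (hb₂ : 0 < b₂) (hc₁ : 0 < c₁) (hc₂ : 0 < c₂)
    (I₁ I₂ : Ω → ℝ)
    (hI₁ : HasLaw I₁ (eggMeasure ω₁ lam₁ a₁ b₁ c₁) P)
    (hI₂ : HasLaw I₂ (eggMeasure ω₂ lam₂ a₂ b₂ c₂) P)
    (hind : IndepFun I₁ I₂ P)
    (r₁ r₂ : ℕ) (hr₁ : r₁ = 1 ∨ r₁ = 2) (hr₂ : r₂ = 1 ∨ r₂ = 2)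
    (η N₁ N₂ C : ℝ) (hη : 0 < η) (hN₁ : 0 < N₁) (hN₂ : 0 < N₂) (hC : 0 < C)
    (γ : Ω → ℝ)
    (hγ : ∀ w, γ w = endToEndSNR C (hopSNR η N₁ r₁ (I₁ w)) (hopSNR η N₂ r₂ (I₂ w)))
    (μ₁ μ₂ : ℝ) (hμ₁ : μ₁ = electricalSNR η N₁ r₁) (hμ₂ : μ₂ = electricalSNR η N₂ r₂)
    (n : ℕ) (δ p : ℝ) (q : Fin n → ℝ) (hp : 0 < p) (hq : ∀ k, 0 < q k) :
    HasPDF γ P volume ∧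
    (∀ k, IntegrableOn (fun x => upperGamma p (q k * x) * (pdf γ P volume x).toReal) (Ioi 0)) ∧
    (∀ k,
      (berFox p (0, r₁) (1, r₂)).WellDefinedAt
        (q k * lam₁ ^ r₁ * μ₁) (C / (lam₂ ^ r₂ * μ₂)) ∧
      (berFox p (0, r₁) (a₂, r₂ / c₂)).WellDefinedAt
        (q k * lam₁ ^ r₁ * μ₁) (C / (b₂ ^ r₂ * μ₂)) ∧
      (berFox p (1 - a₁, r₁ / c₁) (1, r₂)).WellDefinedAt
        (q k * b₁ ^ r₁ * μ₁) (C / (lam₂ ^ r₂ * μ₂)) ∧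
      (berFox p (1 - a₁, r₁ / c₁) (a₂, r₂ / c₂)).WellDefinedAt
        (q k * b₁ ^ r₁ * μ₁) (C / (b₂ ^ r₂ * μ₂))) ∧
    (averageBER δ p q (fun x => (pdf γ P volume x).toReal) : ℂ) =
      δ * ∑ k, (1 / 2
        - ω₁ * ω₂ / (2 * Real.Gamma p) *
          (berFox p (0, r₁) (1, r₂)).foxH
            (q k * lam₁ ^ r₁ * μ₁) (C / (lam₂ ^ r₂ * μ₂))
        - ω₁ * (1 - ω₂) / (2 * Real.Gamma a₂ * Real.Gamma p) *
          (berFox p (0, r₁) (a₂, r₂ / c₂)).foxH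
            (q k * lam₁ ^ r₁ * μ₁) (C / (b₂ ^ r₂ * μ₂))
        - ω₂ * (1 - ω₁) / (2 * Real.Gamma a₁ * Real.Gamma p) *
          (berFox p (1 - a₁, r₁ / c₁) (1, r₂)).foxH
            (q k * b₁ ^ r₁ * μ₁) (C / (lam₂ ^ r₂ * μ₂))
        - (1 - ω₁) * (1 - ω₂) / (2 * Real.Gamma a₁ * Real.Gamma a₂ * Real.Gamma p) *
          (berFox p (1 - a₁, r₁ / c₁) (a₂, r₂ / c₂)).foxH
            (q k * b₁ ^ r₁ * μ₁) (C / (b₂ ^ r₂ * μ₂))) := by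
  have hγ' : γ = fun w => endToEndSNR C (hopSNR η N₁ r₁ (I₁ w)) (hopSNR η N₂ r₂ (I₂ w)) := funext hγ
  have hr₁' : r₁ ≠ 0 := by rcases hr₁ with h | h <;> simp [h]
  have hr₂' : r₂ ≠ 0 := by rcases hr₂ with h | h <;> simp [h]
  have hr₁p : (0 : ℝ) < r₁ := by positivity
  have hr₂p : (0 : ℝ) < r₂ := by positivity
  have hμ₁p : 0 < μ₁ := by rw [hμ₁, electricalSNR]; positivity
  have hμ₂p : 0 < μ₂ := by rw [hμ₂, electricalSNR]; positivity
  have hac₁ : P.map I₁ ≪ volume.restrict (Ioi 0) :=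
    hI₁.map_eq ▸ eggMeasure_absolutelyContinuous _ _ _ _ _
  have hac₂ : P.map I₂ ≪ volume.restrict (Ioi 0) :=
    hI₂.map_eq ▸ eggMeasure_absolutelyContinuous _ _ _ _ _
  have hpdf : HasPDF γ P volume := hγ' ▸ hasPDF_endToEndSNR hη hN₁ hN₂ hC hr₁' hI₁.aemeasurable
    hI₂.aemeasurable hac₁ hac₂ hind
  have hpos : ∀ᵐ w ∂P, 0 < γ w := by
    filter_upwards [ae_of_ae_map hI₁.aemeasurable (hac₁.ae_le (ae_restrict_mem measurableSet_Ioi)),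
      ae_of_ae_map hI₂.aemeasurable (hac₂.ae_le (ae_restrict_mem measurableSet_Ioi))] with w h1 h2
    have h3 := hopSNR_pos hη hN₁ r₁ h1
    have h4 := hopSNR_pos hη hN₂ r₂ h2
    rw [hγ, endToEndSNR]
    positivity
  -- Exhibits the exponential component of the first hop as the case `a₁ = 1` of the pair `(1 - a₁,
  -- α)`.
  have e₁ : ((0 : ℝ), (r₁ : ℝ)) = (1 - 1, (r₁ : ℝ)) := by rw [sub_self]
  rw [e₁]
  refine ⟨hpdf, fun k => (integral_upperGamma_mul_pdf hpos hp (hq k)).1, fun k => ?_, ?_⟩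
  · have hqk := hq k
    exact ⟨berFox_wellDefinedAt hp one_pos one_pos hr₁p hr₂p (by positivity) (by positivity),
      berFox_wellDefinedAt hp one_pos ha₂ hr₁p (by positivity) (by positivity) (by positivity),
      berFox_wellDefinedAt hp ha₁ one_pos (by positivity) hr₂p (by positivity) (by positivity),
      berFox_wellDefinedAt hp ha₁ ha₂ (by positivity) (by positivity) (by positivity)
        (by positivity)⟩
  · have hG : (Real.Gamma p : ℂ) ≠ 0 := by exact_mod_cast (Real.Gamma_pos_of_pos hp).ne'
    have hG₁ : (Real.Gamma a₁ : ℂ) ≠ 0 := by exact_mod_cast (Real.Gamma_pos_of_pos ha₁).ne'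
    have hG₂ : (Real.Gamma a₂ : ℂ) ≠ 0 := by exact_mod_cast (Real.Gamma_pos_of_pos ha₂).ne'
    rw [averageBER, Complex.ofReal_mul, Complex.ofReal_sum, Finset.mul_sum, Finset.mul_sum]
    refine Finset.sum_congr rfl fun k _ => ?_
    have hqk := hq k
    rw [(integral_upperGamma_mul_pdf hpos hp hqk).2]
    simp_rw [hγ]
    rw [integral_lowerGamma_endToEndSNR hω₁ hω₂ hlam₁ hlam₂ ha₁ ha₂ hb₁ hb₂ hc₁ hc₂ hI₁ hI₂ hind hη
      hN₂ hC hp, ← hμ₁, ← hμ₂,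
      berFox_foxH hp one_pos one_pos hr₁p hr₂p (by positivity) (by positivity),
      berFox_foxH hp one_pos ha₂ hr₁p (by positivity) (by positivity) (by positivity),
      berFox_foxH hp ha₁ one_pos (by positivity) hr₂p (by positivity) (by positivity),
      berFox_foxH hp ha₁ ha₂ (by positivity) (by positivity) (by positivity) (by positivity)]
    push_cast
    field_simp
    ring
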